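/- Let $d\ge 1$, $k$, $\ell$ be integers with $2k>d$ and $\ell>2k-d+1$, let $\varepsilon>2k/\ell$, and let $K,C_{sg}>0$. Let $\phi$ be the surface spline on $\mathbb{R}^d$, normalized so that $\Delta^k\phi=\delta_0$: $$\phi(x)=\frac{(-1)^{d/2+1}\,2}{4^k\pi^{d/2}(k-1)!\,(k-d/2)!}\,|x|^{2k-d}\log|x|\ \ (d\text{ even}),\qquad \phi(x)=\frac{(-1)^k\,\Gamma(d/2-k)}{4^k\pi^{d/2}(k-1)!}\,|x|^{2k-d}\ \ (d\text{ odd}),$$ with $\phi(0)=0$. There is a constant $C>0$, depending only on $d,k,\ell,\varepsilon,K,C_{sg}$, such that the following holds. Let $\Xi\subset\mathbb{R}^d$ be a set of centers and let $\rho:\mathbb{R}^d\to(0,\infty)$ be a local density for $\Xi$ of precision $\ell$, i.e. there is a local polynomial reproduction $a:\Xi\times\mathbb{R}^d\to\mathbb{R}$ such that for all $\alpha\in\mathbb{R}^d$: - (Support) $a(\xi,\alpha)=0$ whenever $\xi\in\Xi$ and $|\xi-\alpha|>\rho(\alpha)$; - (Precision) $\sum_{\xi\in\Xi}a(\xi,\alpha)p(\xi)=p(\alpha)$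 for every real polynomial $p$ in $d$ variables of total degree less than $\ell$; - (Stability) $\sum_{\xi\in\Xi}|a(\xi,\alpha)|<K$. Suppose that for each $x$ the function $\alpha\mapsto\sum_{\xi\in\Xi}a(\xi,\alpha)\phi(x-\xi)$ is Lebesgue measurable (which is automatic if $\Xi$ is countable and every $a(\xi,\cdot)$ is measurable), and that $\rho$ exhibits $1-\varepsilon$ slow growth: $$\rho(\alpha)\le C_{sg}\,\rho(x)\left(1+\frac{|x-\alpha|}{\rho(x)}\right)^{1-\varepsilon}\qquad\text{for all }x,\alpha\in\mathbb{R}^d.$$ Then for every compactly supported $f\in C^{2k}(\mathbb{R}^d)$ and every $x\in\mathbb{R}^d$, the sums and the integral in $$T_\Xi f(x):=\int_{\mathbb{R}^d}\Delta^kf(\alpha)\sum_{\xi\in\Xi}a(\xi,\alpha)\,\phi(x-\xi)\,d\alpha$$ converge absolutely, and $$|f(x)-T_\Xi f(x)|\le C\,\rho(x)^{2k}\,\|\Delta^kf\|_\infty .$$ -/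

import Mathlib

/-- The space `ℝ^d` with its Euclidean norm. -/
abbrev RSpace (d : ℕ) : Type := EuclideanSpace ℝ (Fin d)

/-- The surface spline `φ` on `ℝ^d` (for `2 * k > d`), normalized to be a fundamental solution of the
`k`-fold Laplacian `Δ^k`:
* `φ x = (-1)^(d/2+1) * 2 / (4^k π^(d/2) (k-1)! (k-d/2)!) * |x|^(2k-d) * log |x|` for even `d`;
* `φ x = (-1)^k * Γ(d/2-k) / (4^k π^(d/2) (k-1)!) * |x|^(2k-d)` for odd `d`. -/
noncomputable def surfaceSpline (d k : ℕ) (x : RSpace d) : ℝ :=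
  if Even d then
    (-1) ^ (d / 2 + 1) * 2 /
        (4 ^ k * Real.pi ^ (d / 2) * (Nat.factorial (k - 1) : ℝ) *
          (Nat.factorial (k - d / 2) : ℝ)) *
      (‖x‖ ^ (2 * k - d) * Real.log ‖x‖)
  else
    (-1) ^ k * Real.Gamma ((d : ℝ) / 2 - (k : ℝ)) /
        (4 ^ k * Real.pi ^ ((d : ℝ) / 2) * (Nat.factorial (k - 1) : ℝ)) *
      ‖x‖ ^ (2 * k - d)

/-- `ρ : ℝ^d → (0, ∞)` is a local density for the set of centers `Ξ`, with associated `K`-stable local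
polynomial reproduction `a : Ξ × ℝ^d → ℝ` of order `ℓ`: all polynomials of total degree less than `ℓ`
are reproduced. -/
structure IsLocalDensity {d : ℕ} (Ξ : Set (RSpace d)) (ρ : RSpace d → ℝ)
    (a : Ξ → RSpace d → ℝ) (ℓ : ℕ) (K : ℝ) : Prop where
  pos : ∀ α, 0 < ρ α
  support : ∀ (ξ : Ξ) (α : RSpace d), ρ α < ‖(ξ : RSpace d) - α‖ → a ξ α = 0
  precision : ∀ p : MvPolynomial (Fin d) ℝ, p.totalDegree < ℓ → ∀ α : RSpace d,
    HasSum (fun ξ : Ξ => a ξ α * MvPolynomial.eval (fun i => (ξ : RSpace d) i) p)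
      (MvPolynomial.eval (fun i => α i) p)
  summable : ∀ α : RSpace d, Summable (fun ξ : Ξ => |a ξ α|)
  stability : ∀ α : RSpace d, ∑' ξ : Ξ, |a ξ α| < K

/-- `ρ` exhibits `1 - ε` slow growth with constant `Csg`. -/
def SlowGrowth {d : ℕ} (ρ : RSpace d → ℝ) (ε Csg : ℝ) : Prop :=
  ∀ x α : RSpace d, ρ α ≤ Csg * ρ x * (1 + ‖x - α‖ / ρ x) ^ (1 - ε)

/-- The `k`-fold Laplacian `Δ^k f`. -/
noncomputable def iteratedLaplacian {d : ℕ} (k : ℕ) (f : RSpace d → ℝ) : RSpace d → ℝ :=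
  (fun g : RSpace d → ℝ => Laplacian.laplacian g)^[k] f

/-- The local combination `∑ ξ, a(ξ, α) φ(x - ξ)` of shifts of the surface spline. -/
noncomputable def splineKernel {d : ℕ} (k : ℕ) {Ξ : Set (RSpace d)} (a : Ξ → RSpace d → ℝ)
    (x α : RSpace d) : ℝ :=
  ∑' ξ : Ξ, a ξ α * surfaceSpline d k (x - ξ)

/-- The approximant `T_Ξ f (x) = ∫ Δ^k f(α) ∑ ξ, a(ξ, α) φ(x - ξ) dα`. -/
noncomputable def splineApproximant {d : ℕ} (k : ℕ) {Ξ : Set (RSpace d)} (a : Ξ → RSpace d → ℝ)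
    (f : RSpace d → ℝ) (x : RSpace d) : ℝ :=
  ∫ α, iteratedLaplacian k f α * splineKernel k a x α

/-!
The function `|y|^p` satisfies `Δ |y|^(p+2) = (p+2) (p+d) |y|^p` weakly for `p > -d`, so for
`η > 0` the `k`-fold Laplacian of `|y|^(2k-d+η)` is an explicit product times `η |y|^(η-d)`, which
tends to a multiple of `δ₀` as `η → 0`. If `d` is odd, the limit `η → 0` shows `Δ^k φ = δ₀`; if `d`
is even, the product vanishes at `η = 0` and its derivative in `η` produces the logarithm.

Hence `f x = ∫ Δ^k f(α) φ(x - α) dα`, and `f x - T_Ξ f x` is the integral of `Δ^k f` against the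
error of the reproduction `a` applied to `φ(x - ·)`. Up to a polynomial of degree at most `2k - d`,
which `a` reproduces, `φ` is homogeneous of degree `2k - d`, so everything may be rescaled. If
`|x - α| ≤ M ρ(x)`, boundedness of `φ` on compact sets bounds the error by a multiple of
`ρ(x)^(2k-d)`. If `|x - α| > M ρ(x)`, slow growth makes `ρ(α) / |x - α|` at most a multiple of
`(1 + |x - α| / ρ(x))^(-ε)`, and reproducing the Taylor polynomial of `φ` of degree `ℓ - 1` gains
the factor `(ρ(α) / |x - α|)^ℓ`. The resulting bound is a multiple of
`ρ(x)^(2k-d) (1 + |x - α| / ρ(x))^(-(ε ℓ + d - 2k))`, whose integral is a multiple of `ρ(x)^(2k)`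
because `ε ℓ > 2k`.
-/

open MeasureTheory Filter Topology Laplacian Module
open scoped RealInnerProductSpace

/-! ### Green's second identity for the Laplacian -/

section Laplacian

variable {E F : Type*} [NormedAddCommGroup E] [InnerProductSpace ℝ E] [FiniteDimensional ℝ E]
  [NormedAddCommGroup F] [NormedSpace ℝ F]

lemma laplacian_eq_sum_fderiv_fderiv {ι : Type*} [Fintype ι] (b : OrthonormalBasis ι ℝ E)
    {f : E → F} (hf : ContDiff ℝ 2 f) (y : E) :
    Δ f y = ∑ i, fderiv ℝ (fun z => fderiv ℝ f z (b i)) y (b i) := by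
  have hdiff : DifferentiableAt ℝ (fderiv ℝ f) y :=
    (hf.fderiv_right (m := 1) le_rfl).differentiable one_ne_zero y
  rw [InnerProductSpace.laplacian_eq_iteratedFDeriv_orthonormalBasis f b]
  refine Finset.sum_congr rfl fun i _ => ?_
  rw [iteratedFDeriv_two_apply, fderiv_clm_apply hdiff (by fun_prop)]
  simp

lemma contDiff_laplacian {f : E → F} {n : WithTop ℕ∞} (hf : ContDiff ℝ (n + 2) f) :
    ContDiff ℝ n (Δ f) := by
  rw [InnerProductSpace.laplacian_eq_iteratedFDeriv_stdOrthonormalBasis f]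
  refine ContDiff.sum fun i _ => ?_
  exact (ContinuousMultilinearMap.apply ℝ (fun _ : Fin 2 => E) F _).contDiff.comp
    (hf.iteratedFDeriv_right (i := 2) le_rfl)

lemma hasCompactSupport_laplacian {f : E → F} (hf : HasCompactSupport f) :
    HasCompactSupport (Δ f) := by
  refine (hf.iteratedFDeriv (𝕜 := ℝ) 2).mono fun x => mt fun hx => ?_
  rw [InnerProductSpace.laplacian_eq_iteratedFDeriv_stdOrthonormalBasis f]
  simp [hx]

lemma contDiff_iterate_laplacian {f : E → F} {n : WithTop ℕ∞} {k : ℕ}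
    (hf : ContDiff ℝ (n + (2 * k : ℕ)) f) : ContDiff ℝ n (Laplacian.laplacian^[k] f) := by
  induction k generalizing f with
  | zero => simpa using hf
  | succ k ih =>
    refine ih (contDiff_laplacian ?_)
    rwa [add_assoc, show ((2 * k : ℕ) : WithTop ℕ∞) + 2 = (2 * (k + 1) : ℕ) by norm_cast]

lemma hasCompactSupport_iterate_laplacian {f : E → F} (hf : HasCompactSupport f) (k : ℕ) :
    HasCompactSupport (Laplacian.laplacian^[k] f) := by
  induction k generalizing f with
  | zero => exact hf
  | succ _ ih => exact ih (hasCompactSupport_laplacian hf)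

end Laplacian

section Green

variable {E : Type*} [NormedAddCommGroup E] [MeasurableSpace E] [BorelSpace E] {f g : E → ℝ}

lemma integral_fderiv_mul_eq_neg [NormedSpace ℝ E] [FiniteDimensional ℝ E]
    (μ : Measure E) [μ.IsAddHaarMeasure] (hf : ContDiff ℝ 1 f)
    (hc : HasCompactSupport f) (hg : ContDiff ℝ 1 g) (v : E) :
    ∫ y, fderiv ℝ f y v * g y ∂μ = -∫ y, f y * fderiv ℝ g y v ∂μ := by
  have hf' : Continuous fun y => fderiv ℝ f y v :=
    (hf.continuous_fderiv one_ne_zero).clm_apply continuous_const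
  have hg' : Continuous fun y => fderiv ℝ g y v :=
    (hg.continuous_fderiv one_ne_zero).clm_apply continuous_const
  refine eq_neg_iff_add_eq_zero.mpr (neg_eq_iff_add_eq_zero.mp ?_)
  exact (integral_mul_fderiv_eq_neg_fderiv_mul_of_integrable
    ((hf'.mul hg.continuous).integrable_of_hasCompactSupport
      (hc.fderiv_apply (𝕜 := ℝ) v).mul_right)
    ((hf.continuous.mul hg').integrable_of_hasCompactSupport hc.mul_right)
    ((hf.continuous.mul hg.continuous).integrable_of_hasCompactSupport hc.mul_right)
    (fun x _ => hf.differentiable one_ne_zero x)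
    (fun x _ => hg.differentiable one_ne_zero x)).symm

variable [InnerProductSpace ℝ E] [FiniteDimensional ℝ E]

lemma integral_laplacian_mul_eq (μ : Measure E) [μ.IsAddHaarMeasure]
    (hf : ContDiff ℝ 2 f) (hc : HasCompactSupport f) (hg : ContDiff ℝ 2 g) :
    ∫ y, Δ f y * g y ∂μ = ∫ y, f y * Δ g y ∂μ := by
  set b := stdOrthonormalBasis ℝ E
  have hD : ∀ {h : E → ℝ}, ContDiff ℝ 2 h → ∀ v, ContDiff ℝ 1 fun y => fderiv ℝ h y v :=
    fun hh v => (hh.fderiv_right (m := 1) le_rfl).clm_apply contDiff_const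
  have hDD : ∀ {h : E → ℝ}, ContDiff ℝ 2 h → ∀ v,
      Continuous fun y => fderiv ℝ (fun z => fderiv ℝ h z v) y v :=
    fun hh v => ((hD hh v).continuous_fderiv one_ne_zero).clm_apply continuous_const
  simp_rw [laplacian_eq_sum_fderiv_fderiv b hf, laplacian_eq_sum_fderiv_fderiv b hg,
    Finset.sum_mul, Finset.mul_sum]
  rw [integral_finsetSum, integral_finsetSum]
  · refine Finset.sum_congr rfl fun i _ => ?_
    rw [integral_fderiv_mul_eq_neg μ (hD hf _) (hc.fderiv_apply (𝕜 := ℝ) _)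
      (hg.of_le one_le_two), integral_fderiv_mul_eq_neg μ (hf.of_le one_le_two) hc (hD hg _),
      neg_neg]
  · exact fun i _ => (hf.continuous.mul (hDD hg _)).integrable_of_hasCompactSupport hc.mul_right
  · exact fun i _ => ((hDD hf _).mul hg.continuous).integrable_of_hasCompactSupport
      ((hc.fderiv_apply (𝕜 := ℝ) _).fderiv_apply (𝕜 := ℝ) _).mul_right

end Green

/-! ### Weak Laplacian of powers of the norm -/

section Regularization

variable {E : Type*} [NormedAddCommGroup E] [InnerProductSpace ℝ E] {τ : ℝ}

lemma contDiff_norm_sub_sq_add_rpow (x : E) (hτ : 0 < τ) (s : ℝ) {n : WithTop ℕ∞} :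
    ContDiff ℝ n fun y : E => (‖y - x‖ ^ 2 + τ) ^ s :=
  ContDiff.rpow_const_of_ne (((contDiff_id.sub contDiff_const).norm_sq ℝ).add contDiff_const)
    fun y => by positivity

lemma fderiv_norm_sub_sq_add_rpow (x : E) (hτ : 0 < τ) (s : ℝ) (y v : E) :
    fderiv ℝ (fun y : E => (‖y - x‖ ^ 2 + τ) ^ s) y v =
      2 * s * (⟪y - x, v⟫ * (‖y - x‖ ^ 2 + τ) ^ (s - 1)) := by
  have hsq : HasFDerivAt (fun y : E => ‖y - x‖ ^ 2 + τ) (2 • innerSL ℝ (y - x)) y := by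
    simpa using ((hasFDerivAt_id y).sub_const x).norm_sq.add_const τ
  rw [(hsq.rpow_const (p := s) (Or.inl (by positivity))).fderiv]
  simp only [smul_apply, coe_innerSL_apply, nsmul_eq_mul, smul_eq_mul]
  push_cast
  ring

lemma fderiv_fderiv_norm_sub_sq_add_rpow (x : E) (hτ : 0 < τ) (s : ℝ) (y v : E) :
    fderiv ℝ (fun z => fderiv ℝ (fun y : E => (‖y - x‖ ^ 2 + τ) ^ s) z v) y v =
      2 * s * ‖v‖ ^ 2 * (‖y - x‖ ^ 2 + τ) ^ (s - 1) +
        4 * s * (s - 1) * ⟪y - x, v⟫ ^ 2 * (‖y - x‖ ^ 2 + τ) ^ (s - 2) := by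
  simp_rw [fderiv_norm_sub_sq_add_rpow x hτ s]
  have hinner : HasFDerivAt (fun z : E => ⟪z - x, v⟫) (innerSL ℝ v) y := by
    simp_rw [real_inner_comm v]
    exact (innerSL ℝ v).hasFDerivAt.comp y ((hasFDerivAt_id y).sub_const x)
  have hpow := ((contDiff_norm_sub_sq_add_rpow x hτ (s - 1) (n := 1)).differentiable
    one_ne_zero y).hasFDerivAt
  have hpow' := fderiv_norm_sub_sq_add_rpow x hτ (s - 1) y v
  rw [sub_sub, one_add_one_eq_two] at hpow'
  rw [((hinner.fun_mul hpow).const_mul (2 * s)).fderiv]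
  simp only [smul_apply, add_apply, smul_eq_mul, hpow', coe_innerSL_apply,
    real_inner_self_eq_norm_sq]
  ring

lemma laplacian_norm_sub_sq_add_rpow [FiniteDimensional ℝ E] (x : E) (hτ : 0 < τ) (s : ℝ) (y : E) :
    Δ (fun y : E => (‖y - x‖ ^ 2 + τ) ^ s) y =
      2 * s * (finrank ℝ E + 2 * (s - 1)) * (‖y - x‖ ^ 2 + τ) ^ (s - 1) -
        4 * s * (s - 1) * (τ * (‖y - x‖ ^ 2 + τ) ^ (s - 2)) := by
  have hpow : (‖y - x‖ ^ 2 + τ) ^ (s - 1) =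
      (‖y - x‖ ^ 2 + τ) * (‖y - x‖ ^ 2 + τ) ^ (s - 2) := by
    rw [show s - 1 = 1 + (s - 2) by ring, Real.rpow_add (by positivity), Real.rpow_one]
  rw [laplacian_eq_sum_fderiv_fderiv (stdOrthonormalBasis ℝ E)
    (contDiff_norm_sub_sq_add_rpow x hτ s)]
  simp_rw [fderiv_fderiv_norm_sub_sq_add_rpow x hτ s, OrthonormalBasis.norm_eq_one, one_pow,
    mul_one]
  rw [Finset.sum_add_distrib, Finset.sum_const, ← Finset.sum_mul, ← Finset.mul_sum,
    OrthonormalBasis.sum_sq_inner_left, Finset.card_univ, Fintype.card_fin, hpow, nsmul_eq_mul]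
  ring

end Regularization

lemma sq_add_rpow_le_rpow_add_rpow {r τ : ℝ} (hr : 0 < r) (hτ : τ ∈ Set.Ioc 0 1) (s : ℝ) :
    (r ^ 2 + τ) ^ s ≤ r ^ (2 * s) + (r ^ 2 + 1) ^ s := by
  obtain ⟨hτ₀, hτ₁⟩ := hτ
  rw [Real.rpow_mul hr.le, Real.rpow_two]
  rcases le_total 0 s with hs | hs
  · exact (Real.rpow_le_rpow (by positivity) (by linarith) hs).trans
      (le_add_of_nonneg_left (by positivity))
  · exact (Real.rpow_le_rpow_of_nonpos (by positivity) (by linarith) hs).trans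
      (le_add_of_nonneg_right (by positivity))

lemma mul_sq_add_rpow_sub_two_le {r τ : ℝ} (hτ : 0 < τ) (s : ℝ) :
    τ * (r ^ 2 + τ) ^ (s - 2) ≤ (r ^ 2 + τ) ^ (s - 1) := by
  rw [show s - 1 = 1 + (s - 2) by ring, Real.rpow_add (by positivity), Real.rpow_one]
  gcongr
  exact le_add_of_nonneg_left (sq_nonneg r)

lemma tendsto_norm_sub_sq_add_rpow {E : Type*} [NormedAddCommGroup E] {x y : E} (hy : y ≠ x)
    (s : ℝ) :
    Tendsto (fun τ : ℝ => (‖y - x‖ ^ 2 + τ) ^ s) (𝓝[>] 0) (𝓝 (‖y - x‖ ^ (2 * s))) := by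
  have hpos : 0 < ‖y - x‖ := norm_sub_pos_iff.mpr hy
  have h : ContinuousAt (fun τ : ℝ => (‖y - x‖ ^ 2 + τ) ^ s) 0 :=
    ContinuousAt.rpow_const (by fun_prop) (Or.inl (by positivity))
  simpa [Real.rpow_mul hpos.le] using h.tendsto.mono_left nhdsWithin_le_nhds

section RadialIntegrability

variable {E : Type*} [NormedAddCommGroup E] [NormedSpace ℝ E] [FiniteDimensional ℝ E]
  [Nontrivial E] [MeasurableSpace E] [BorelSpace E] {μ : Measure E} [μ.IsAddHaarMeasure]
  {g : E → ℝ}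

lemma integrable_mul_norm_sub_rpow (hg : Continuous g) (hc : HasCompactSupport g) (x : E) {p : ℝ}
    (hp : -(finrank ℝ E : ℝ) < p) : Integrable (fun y => g y * ‖y - x‖ ^ p) μ := by
  have hloc : LocallyIntegrable (fun y : E => ‖y‖ ^ p) μ := by
    have hmeas : Measurable fun y : E => ‖y‖ ^ p := by fun_prop
    refine locallyIntegrable_of_norm_le_rpow (C := 1) (α := -p) finrank_pos (by linarith)
      (ae_of_all _ fun y => ?_) hmeas.aestronglyMeasurable
    rw [neg_neg, one_mul, Real.norm_of_nonneg (by positivity)]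
  have hint := hloc.integrable_smul_left_of_hasCompactSupport (g := fun y => g (y + x))
    (by fun_prop) (hc.comp_homeomorph (Homeomorph.addRight x))
  simpa using hint.comp_sub_right x

lemma tendsto_integral_mul_of_abs_le_norm_sub_sq_add_rpow (hg : Continuous g)
    (hc : HasCompactSupport g) {F : ℝ → E → ℝ} {F₀ : E → ℝ} {x : E} {C s : ℝ}
    (hs : -(finrank ℝ E : ℝ) < 2 * s) (hF : ∀ τ, 0 < τ → Continuous (F τ))
    (hle : ∀ τ, 0 < τ → ∀ y, |F τ y| ≤ C * (‖y - x‖ ^ 2 + τ) ^ s)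
    (hlim : ∀ y, y ≠ x → Tendsto (F · y) (𝓝[>] 0) (𝓝 (F₀ y))) :
    Tendsto (fun τ => ∫ y, g y * F τ y ∂μ) (𝓝[>] 0) (𝓝 (∫ y, g y * F₀ y ∂μ)) := by
  have hne : ∀ᵐ y ∂μ, y ≠ x := compl_mem_ae_iff.mpr (measure_singleton x)
  have hC : 0 ≤ C := nonneg_of_mul_nonneg_left ((abs_nonneg _).trans (hle 1 one_pos x))
    (by positivity)
  have hbound : Integrable
      (fun y => C * (|g y| * ‖y - x‖ ^ (2 * s) + |g y| * (‖y - x‖ ^ 2 + 1) ^ s)) μ := by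
    refine (Integrable.add ?_ ?_).const_mul C
    · exact integrable_mul_norm_sub_rpow hg.abs hc.abs x hs
    · refine (hg.abs.mul (Continuous.rpow_const (by fun_prop) fun y => ?_)
        ).integrable_of_hasCompactSupport hc.abs.mul_right
      exact Or.inl (by positivity)
  refine tendsto_integral_filter_of_dominated_convergence _ ?_ ?_ hbound ?_
  · filter_upwards [self_mem_nhdsWithin] with τ hτ
    exact (hg.mul (hF τ hτ)).aestronglyMeasurable
  · filter_upwards [Ioc_mem_nhdsGT (zero_lt_one' ℝ)] with τ hτ
    filter_upwards [hne] with y hy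
    rw [norm_mul, Real.norm_eq_abs, Real.norm_eq_abs, ← mul_add, mul_left_comm]
    refine mul_le_mul_of_nonneg_left ((hle τ hτ.1 y).trans ?_) (abs_nonneg _)
    gcongr
    exact sq_add_rpow_le_rpow_add_rpow (norm_sub_pos_iff.mpr hy) hτ s
  · filter_upwards [hne] with y hy
    exact (hlim y hy).const_mul _

end RadialIntegrability

section RadialLaplacian

variable {E : Type*} [NormedAddCommGroup E] [InnerProductSpace ℝ E] [FiniteDimensional ℝ E]
  [Nontrivial E] [MeasurableSpace E] [BorelSpace E] (μ : Measure E) [μ.IsAddHaarMeasure]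
  {f : E → ℝ}

lemma tendsto_integral_mul_laplacian_norm_sub_sq_add_rpow {g : E → ℝ} (hg : Continuous g)
    (hc : HasCompactSupport g) (x : E) {s : ℝ} (hs : -(finrank ℝ E : ℝ) < 2 * (s - 1)) :
    Tendsto (fun τ : ℝ => ∫ y, g y * Δ (fun z : E => (‖z - x‖ ^ 2 + τ) ^ s) y ∂μ) (𝓝[>] 0)
      (𝓝 (2 * s * (finrank ℝ E + 2 * (s - 1)) * ∫ y, g y * ‖y - x‖ ^ (2 * (s - 1)) ∂μ)) := by
  rw [← integral_const_mul]
  simp_rw [mul_left_comm _ (g _)]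
  refine tendsto_integral_mul_of_abs_le_norm_sub_sq_add_rpow (x := x) (s := s - 1)
    (C := |2 * s * (finrank ℝ E + 2 * (s - 1))| + |4 * s * (s - 1)|) hg hc hs
    (fun τ hτ => (contDiff_laplacian
      (contDiff_norm_sub_sq_add_rpow (n := 0 + 2) x hτ s)).continuous)
    (fun τ hτ y => ?_) fun y hy => ?_
  · have hpos (t : ℝ) : 0 ≤ (‖y - x‖ ^ 2 + τ) ^ t := by positivity
    rw [laplacian_norm_sub_sq_add_rpow x hτ, add_mul]
    refine (abs_sub _ _).trans (add_le_add (le_of_eq ?_) ?_)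
    · rw [abs_mul, abs_of_nonneg (hpos _)]
    · rw [abs_mul, abs_of_nonneg (mul_nonneg hτ.le (hpos _))]
      exact mul_le_mul_of_nonneg_left (mul_sq_add_rpow_sub_two_le hτ s) (abs_nonneg _)
  · have hlim := ((tendsto_norm_sub_sq_add_rpow hy (s - 1)).const_mul
      (2 * s * (finrank ℝ E + 2 * (s - 1)))).sub
        (((tendsto_id.mono_left nhdsWithin_le_nhds).mul
          (tendsto_norm_sub_sq_add_rpow hy (s - 2))).const_mul (4 * s * (s - 1)))
    rw [zero_mul, mul_zero, sub_zero] at hlim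
    refine hlim.congr' ?_
    filter_upwards [self_mem_nhdsWithin] with τ hτ
    exact (laplacian_norm_sub_sq_add_rpow x hτ s y).symm

lemma integral_laplacian_mul_norm_sub_rpow (hf : ContDiff ℝ 2 f) (hc : HasCompactSupport f)
    (x : E) {p : ℝ} (hp : -(finrank ℝ E : ℝ) < p) :
    ∫ y, Δ f y * ‖y - x‖ ^ (p + 2) ∂μ =
      (p + 2) * (p + finrank ℝ E) * ∫ y, f y * ‖y - x‖ ^ p ∂μ := by
  obtain ⟨s, rfl⟩ : ∃ s, p = 2 * (s - 1) := ⟨(p + 2) / 2, by ring⟩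
  have hleft : Tendsto (fun τ => ∫ y, Δ f y * (‖y - x‖ ^ 2 + τ) ^ s ∂μ) (𝓝[>] 0)
      (𝓝 (∫ y, Δ f y * ‖y - x‖ ^ (2 * s) ∂μ)) :=
    tendsto_integral_mul_of_abs_le_norm_sub_sq_add_rpow (C := 1) (s := s)
      (contDiff_laplacian (n := 0) hf).continuous (hasCompactSupport_laplacian hc) (by linarith)
      (fun τ hτ => (contDiff_norm_sub_sq_add_rpow x hτ s (n := 0)).continuous)
      (fun τ hτ y => by rw [one_mul, abs_of_nonneg (by positivity)])
      fun y hy => tendsto_norm_sub_sq_add_rpow hy s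
  have hgreen : (fun τ => ∫ y, Δ f y * (‖y - x‖ ^ 2 + τ) ^ s ∂μ) =ᶠ[𝓝[>] 0]
      fun τ => ∫ y, f y * Δ (fun z : E => (‖z - x‖ ^ 2 + τ) ^ s) y ∂μ := by
    filter_upwards [self_mem_nhdsWithin] with τ hτ
    exact integral_laplacian_mul_eq μ hf hc (contDiff_norm_sub_sq_add_rpow x hτ s)
  rw [show 2 * (s - 1) + 2 = 2 * s by ring, tendsto_nhds_unique (hleft.congr' hgreen)
    (tendsto_integral_mul_laplacian_norm_sub_sq_add_rpow μ hf.continuous hc x hp)]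
  ring

lemma integral_iterate_laplacian_mul_norm_sub_rpow {k : ℕ} (hf : ContDiff ℝ (2 * k : ℕ) f)
    (hc : HasCompactSupport f) (x : E) {p : ℝ} (hp : -(finrank ℝ E : ℝ) < p) :
    ∫ y, (Laplacian.laplacian^[k] f) y * ‖y - x‖ ^ (p + 2 * k) ∂μ =
      (∏ i ∈ Finset.range k, ((p + 2 * (i + 1)) * (p + 2 * i + finrank ℝ E))) *
        ∫ y, f y * ‖y - x‖ ^ p ∂μ := by
  induction k generalizing f p with
  | zero => simp
  | succ k ih =>
    have hΔ := ih (contDiff_laplacian (by exact_mod_cast hf)) (hasCompactSupport_laplacian hc)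
      (p := p + 2) (by linarith)
    rw [integral_laplacian_mul_norm_sub_rpow μ (hf.of_le (by norm_cast; lia)) hc x hp,
      ← mul_assoc] at hΔ
    rw [Function.iterate_succ_apply, show p + 2 * ((k + 1 : ℕ) : ℝ) = p + 2 + 2 * k by
      push_cast; ring, hΔ, Finset.prod_range_succ']
    push_cast
    congr 2
    · exact Finset.prod_congr rfl fun i _ => by ring
    · ring

end RadialLaplacian

/-! ### Riesz potentials of small order and derivatives in the exponent -/

lemma tendstoUniformlyOn_mul_norm_sub_rpow {E : Type*} [NormedAddCommGroup E] (c : ℝ) {n : ℝ}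
    (hn : 0 < n) {x : E} {u : Set E} (hu : u ∈ 𝓝 x) :
    TendstoUniformlyOn (fun (η : ℝ) y => η / c * ‖y - x‖ ^ (η - n)) 0 (𝓝[>] 0) uᶜ := by
  obtain ⟨δ, hδ, hball⟩ := Metric.mem_nhds_iff.mp hu
  have hlim : Tendsto (fun η : ℝ => |η / c| * δ ^ (η - n)) (𝓝[>] 0) (𝓝 0) := by
    have : Continuous fun η : ℝ => |η / c| * δ ^ (η - n) :=
      (continuous_abs.comp (continuous_id.div_const c)).mul
        ((Real.continuous_const_rpow hδ.ne').comp (continuous_sub_right n))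
    simpa using (this.tendsto 0).mono_left nhdsWithin_le_nhds
  rw [Metric.tendstoUniformlyOn_iff]
  intro ε hε
  filter_upwards [hlim.eventually_lt_const hε, Ioo_mem_nhdsGT hn] with η hη hηn y hy
  have hδy : δ ≤ ‖y - x‖ := by
    simpa [dist_eq_norm] using fun h => hy (hball h)
  rw [Pi.zero_apply, dist_zero_left, norm_mul, Real.norm_eq_abs, Real.norm_eq_abs,
    abs_of_nonneg (by positivity : 0 ≤ ‖y - x‖ ^ (η - n))]
  exact (mul_le_mul_of_nonneg_left
    (Real.rpow_le_rpow_of_nonpos hδ hδy (sub_nonpos.mpr hηn.2.le)) (abs_nonneg _)).trans_lt hη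

section RieszPotential

variable {E : Type*} [NormedAddCommGroup E] [NormedSpace ℝ E] [FiniteDimensional ℝ E]
  [Nontrivial E] [MeasurableSpace E] [BorelSpace E] (μ : Measure E) [μ.IsAddHaarMeasure]

lemma setIntegral_ball_norm_sub_rpow (x : E) {η : ℝ} (hη : 0 < η) :
    ∫ y in Metric.ball x 1, ‖y - x‖ ^ (η - finrank ℝ E) ∂μ =
      finrank ℝ E * μ.real (Metric.ball 0 1) / η := by
  have hradial : ∫ t in Set.Ioi (0 : ℝ), t ^ (finrank ℝ E - 1) •
      (Set.Iio (1 : ℝ)).indicator (fun t => t ^ (η - finrank ℝ E)) t = 1 / η := by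
    have hpow : ∀ t ∈ Set.Ioi (0 : ℝ), t ^ (finrank ℝ E - 1) •
        (Set.Iio (1 : ℝ)).indicator (fun t => t ^ (η - finrank ℝ E)) t =
          (Set.Iio (1 : ℝ)).indicator (fun t => t ^ (η - 1)) t := by
      intro t ht
      simp only [Set.indicator, smul_eq_mul, mul_ite, mul_zero]
      rw [← Real.rpow_natCast, ← Real.rpow_add ht, Nat.cast_pred finrank_pos]
      ring_nf
    rw [setIntegral_congr_fun measurableSet_Ioi hpow, setIntegral_indicator measurableSet_Iio,
      Set.Ioi_inter_Iio, ← integral_Ioc_eq_integral_Ioo,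
      ← intervalIntegral.integral_of_le zero_le_one, integral_rpow (Or.inl (by linarith))]
    simp [hη.ne']
  calc ∫ y in Metric.ball x 1, ‖y - x‖ ^ (η - finrank ℝ E) ∂μ
      = ∫ y, (Set.Iio (1 : ℝ)).indicator (fun t => t ^ (η - finrank ℝ E)) ‖y - x‖ ∂μ := by
        rw [← integral_indicator Metric.isOpen_ball.measurableSet]
        simp only [Set.indicator, mem_ball_iff_norm, Set.mem_Iio]
    _ = finrank ℝ E * μ.real (Metric.ball 0 1) / η := by
        rw [integral_sub_right_eq_self
          (fun y => (Set.Iio (1 : ℝ)).indicator (fun t => t ^ (η - finrank ℝ E)) ‖y‖) x,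
          integral_fun_norm_addHaar, hradial]
        simp only [nsmul_eq_mul, smul_eq_mul]
        ring

lemma tendsto_mul_integral_norm_sub_rpow {f : E → ℝ} (hf : Integrable f μ) {x : E}
    (hx : ContinuousAt f x) :
    Tendsto (fun η : ℝ => η * ∫ y, f y * ‖y - x‖ ^ (η - finrank ℝ E) ∂μ) (𝓝[>] 0)
      (𝓝 (finrank ℝ E * μ.real (Metric.ball 0 1) * f x)) := by
  set c : ℝ := finrank ℝ E * μ.real (Metric.ball 0 1) with hc
  have hn : (0 : ℝ) < finrank ℝ E := by exact_mod_cast finrank_pos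
  have hcpos : 0 < c := mul_pos hn
    (ENNReal.toReal_pos (Metric.measure_ball_pos μ 0 one_pos).ne' measure_ball_lt_top.ne)
  have hpeak : Tendsto (fun η : ℝ => ∫ y, (η / c * ‖y - x‖ ^ (η - finrank ℝ E)) • f y ∂μ) (𝓝[>] 0)
      (𝓝 (f x)) := by
    refine tendsto_integral_peak_smul_of_integrable_of_tendsto Metric.isOpen_ball.measurableSet
      (Metric.ball_mem_nhds x one_pos) measure_ball_lt_top.ne ?_
      (fun u hu hxu => tendstoUniformlyOn_mul_norm_sub_rpow c hn (hu.mem_nhds hxu)) ?_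
      (Eventually.of_forall fun η => Measurable.aestronglyMeasurable (by fun_prop)) hf hx
    · filter_upwards [self_mem_nhdsWithin] with η (hη : 0 < η) y
      positivity
    · refine tendsto_const_nhds.congr' ?_
      filter_upwards [self_mem_nhdsWithin] with η (hη : 0 < η)
      rw [integral_const_mul, setIntegral_ball_norm_sub_rpow μ x hη, ← hc]
      field_simp
  refine (hpeak.const_mul c).congr fun η => ?_
  simp_rw [smul_eq_mul, mul_assoc, integral_const_mul, mul_comm (_ ^ _)]
  field_simp

end RieszPotential

section ExponentDerivative

lemma abs_rpow_mul_log_le {r a b p : ℝ} (hr : 0 ≤ r) (ha : 0 < a) (hp : p ∈ Set.Icc a b) :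
    |r ^ p * Real.log r| ≤ 1 / a + r ^ (b + 1) := by
  have hp₀ : 0 < p := ha.trans_le hp.1
  rcases hr.eq_or_lt with rfl | hr
  · simp only [Real.log_zero, mul_zero, abs_zero]
    positivity
  rcases le_total r 1 with hr₁ | hr₁
  · rw [mul_comm]
    calc |Real.log r * r ^ p| ≤ 1 / p := (Real.abs_log_mul_self_rpow_lt r p hr hr₁ hp₀).le
      _ ≤ 1 / a := one_div_le_one_div_of_le ha hp.1
      _ ≤ 1 / a + r ^ (b + 1) := le_add_of_nonneg_right (by positivity)
  · have hlog : 0 ≤ Real.log r := Real.log_nonneg hr₁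
    calc |r ^ p * Real.log r| = r ^ p * Real.log r := abs_of_nonneg (by positivity)
      _ ≤ r ^ b * r := mul_le_mul (Real.rpow_le_rpow_of_exponent_le hr₁ hp.2)
          (Real.log_le_self hr.le) hlog (by positivity)
      _ = r ^ (b + 1) := by rw [Real.rpow_add_one hr.ne']
      _ ≤ 1 / a + r ^ (b + 1) := le_add_of_nonneg_left (by positivity)

lemma hasDerivAt_const_rpow {r p : ℝ} (hr : 0 ≤ r) (hp : 0 < p) :
    HasDerivAt (fun q => r ^ q) (r ^ p * Real.log r) p := by
  rcases hr.eq_or_lt with rfl | hr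
  · rw [Real.log_zero, mul_zero]
    refine (hasDerivAt_const p (0 : ℝ)).congr_of_eventuallyEq ?_
    filter_upwards [lt_mem_nhds hp] with q hq
    exact Real.zero_rpow hq.ne'
  · exact (Real.hasStrictDerivAt_const_rpow hr p).hasDerivAt

lemma hasDerivAt_integral_mul_norm_sub_rpow {E : Type*} [NormedAddCommGroup E]
    [MeasurableSpace E] [BorelSpace E] (μ : Measure E) [IsFiniteMeasureOnCompacts μ] {g : E → ℝ}
    (hg : Continuous g) (hc : HasCompactSupport g) (x : E) {q : ℝ} (hq : 0 < q) :
    HasDerivAt (fun p : ℝ => ∫ y, g y * ‖y - x‖ ^ p ∂μ)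
      (∫ y, g y * (‖y - x‖ ^ q * Real.log ‖y - x‖) ∂μ) q := by
  have hmem : Set.Icc (q / 2) (2 * q) ∈ 𝓝 q := Icc_mem_nhds (by linarith) (by linarith)
  have hcont {p : ℝ} (hp : 0 < p) : Continuous fun y => g y * ‖y - x‖ ^ p :=
    hg.mul (Continuous.rpow_const (by fun_prop) fun _ => Or.inr hp.le)
  refine (hasDerivAt_integral_of_dominated_loc_of_deriv_le
    (F' := fun p y => g y * (‖y - x‖ ^ p * Real.log ‖y - x‖))
    (bound := fun y => |g y| * (1 / (q / 2) + ‖y - x‖ ^ (2 * q + 1))) hmem ?_ ?_ ?_ ?_ ?_ ?_).2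
  · filter_upwards [lt_mem_nhds hq] with p hp
    exact (hcont hp).aestronglyMeasurable
  · exact (hcont hq).integrable_of_hasCompactSupport hc.mul_right
  · exact Measurable.aestronglyMeasurable (by fun_prop)
  · refine ae_of_all _ fun y p hp => ?_
    rw [norm_mul, Real.norm_eq_abs, Real.norm_eq_abs]
    gcongr
    exact abs_rpow_mul_log_le (norm_nonneg _) (by positivity) hp
  · refine Continuous.integrable_of_hasCompactSupport ?_ hc.abs.mul_right
    exact hg.abs.mul (continuous_const.add (Continuous.rpow_const (by fun_prop)
      fun _ => Or.inr (by positivity)))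
  · exact ae_of_all _ fun y p hp => (hasDerivAt_const_rpow (norm_nonneg _)
      ((half_pos hq).trans_le hp.1)).const_mul _

end ExponentDerivative

/-! ### The surface spline as a fundamental solution -/

section Products

lemma prod_range_two_mul_succ (n : ℕ) :
    ∏ i ∈ Finset.range n, (2 * ((i : ℝ) + 1)) = 2 ^ n * n.factorial := by
  rw [Finset.prod_mul_distrib, Finset.prod_const, Finset.card_range,
    ← Finset.prod_range_add_one_eq_factorial]
  push_cast
  rfl

lemma prod_range_two_mul_sub (x : ℝ) (k : ℕ) :
    ∏ i ∈ Finset.range k, (2 * ((i : ℝ) + 1) - 2 * x) =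
      (-2) ^ k * ∏ i ∈ Finset.range k, (x - (i + 1)) := by
  rw [← Finset.card_range k, ← Finset.prod_const, Finset.card_range, ← Finset.prod_mul_distrib]
  exact Finset.prod_congr rfl fun i _ => by ring

lemma Gamma_sub_natCast_mul_prod {x : ℝ} {k : ℕ} (hx : ∀ i < k, x ≠ i + 1) :
    Real.Gamma (x - k) * ∏ i ∈ Finset.range k, (x - (i + 1)) = Real.Gamma x := by
  induction k with
  | zero => simp
  | succ k ih =>
    have hΓ := Real.Gamma_add_one (sub_ne_zero.mpr (hx k k.lt_succ_self))
    rw [show x - (k + 1) + 1 = x - k by ring] at hΓ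
    rw [← ih fun i hi => hx i (by lia), Finset.prod_range_succ, hΓ]
    push_cast
    ring

lemma prod_range_natCast_sub (a : ℕ) :
    ∏ i ∈ Finset.range a, ((i : ℝ) - a) = (-1) ^ a * a.factorial := by
  rw [← Finset.prod_range_reflect, ← Finset.prod_range_add_one_eq_factorial, Nat.cast_prod,
    ← Finset.card_range a, ← Finset.prod_const, Finset.card_range, ← Finset.prod_mul_distrib]
  refine Finset.prod_congr rfl fun i hi => ?_
  have : i + 1 ≤ a := Finset.mem_range.mp hi
  rw [show a - 1 - i = a - (i + 1) by lia]
  push_cast [this]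
  ring

lemma prod_erase_range_natCast_sub (a j : ℕ) :
    ∏ i ∈ (Finset.range (a + 1 + j)).erase a, ((i : ℝ) - a) =
      (-1) ^ a * a.factorial * j.factorial := by
  induction j with
  | zero => simp [Finset.range_add_one, prod_range_natCast_sub]
  | succ j ih =>
    rw [← add_assoc, Finset.range_add_one, Finset.erase_insert_of_ne (by lia),
      Finset.prod_insert (by simp), ih, Nat.factorial_succ]
    push_cast
    ring

lemma prod_erase_range_two_mul_sub (a j : ℕ) :
    ∏ i ∈ (Finset.range (a + 1 + j)).erase a, (2 * ((i : ℝ) + 1) - (2 * (a + 1) : ℕ)) =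
      2 ^ (a + j) * ((-1) ^ a * a.factorial * j.factorial) := by
  have hcard : ((Finset.range (a + 1 + j)).erase a).card = a + j := by
    rw [Finset.card_erase_of_mem (Finset.mem_range.mpr (by lia)), Finset.card_range]
    lia
  rw [← prod_erase_range_natCast_sub, ← hcard, ← Finset.prod_const, ← Finset.prod_mul_distrib]
  refine Finset.prod_congr rfl fun i _ => ?_
  push_cast
  ring

end Products

section FundamentalSolution

variable {E : Type*} [NormedAddCommGroup E] [InnerProductSpace ℝ E] [FiniteDimensional ℝ E]
  [Nontrivial E] [MeasurableSpace E] [BorelSpace E]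

variable (E) in
lemma finrank_mul_volume_real_ball :
    finrank ℝ E * volume.real (Metric.ball (0 : E) 1) =
      2 * Real.pi ^ ((finrank ℝ E : ℝ) / 2) / Real.Gamma ((finrank ℝ E : ℝ) / 2) := by
  have hn : (0 : ℝ) < finrank ℝ E := by exact_mod_cast finrank_pos
  have : 0 < Real.Gamma ((finrank ℝ E : ℝ) / 2) := Real.Gamma_pos_of_pos (by positivity)
  have hpi : √Real.pi ^ finrank ℝ E = Real.pi ^ ((finrank ℝ E : ℝ) / 2) := by
    rw [Real.sqrt_eq_rpow, ← Real.rpow_mul_natCast Real.pi_pos.le]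
    ring_nf
  rw [measureReal_def, InnerProductSpace.volume_ball, Real.Gamma_add_one (by positivity), hpi,
    ENNReal.ofReal_one, one_pow, one_mul, ENNReal.toReal_ofReal (by positivity)]
  field_simp

variable (μ : Measure E) [μ.IsAddHaarMeasure] {f : E → ℝ} {k : ℕ}

lemma integral_iterate_laplacian_mul_norm_sub_rpow_add (hk : 0 < k)
    (hf : ContDiff ℝ (2 * k : ℕ) f) (hc : HasCompactSupport f) (x : E) {η : ℝ} (hη : 0 < η) :
    ∫ y, (Laplacian.laplacian^[k] f) y * ‖y - x‖ ^ (2 * k - finrank ℝ E + η) ∂μ =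
      (∏ i ∈ Finset.range k, (2 * ((i : ℝ) + 1) - finrank ℝ E + η)) *
        (∏ i ∈ Finset.range (k - 1), (2 * ((i : ℝ) + 1) + η)) *
          (η * ∫ y, f y * ‖y - x‖ ^ (η - finrank ℝ E) ∂μ) := by
  obtain ⟨k, rfl⟩ := Nat.exists_eq_add_one.mpr hk
  have h := integral_iterate_laplacian_mul_norm_sub_rpow μ hf hc x (p := η - finrank ℝ E)
    (by linarith)
  have hshift (i : ℕ) : η - finrank ℝ E + 2 * i + finrank ℝ E = 2 * i + η := by ring
  have hshift' (i : ℕ) :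
      η - finrank ℝ E + 2 * (i + 1) = 2 * ((i : ℝ) + 1) - finrank ℝ E + η := by ring
  simp_rw [Finset.prod_mul_distrib, hshift, hshift',
    Finset.prod_range_succ' (fun i : ℕ => 2 * (i : ℝ) + η)] at h
  rw [add_comm (_ - _ : ℝ), ← add_sub_assoc, add_sub_right_comm, h]
  push_cast
  ring

lemma tendsto_prod_add_mul_integral_norm_sub_rpow (s : Finset ℕ) (c : ℕ → ℝ) (m : ℕ)
    (hf : Integrable f μ) {x : E} (hx : ContinuousAt f x) :
    Tendsto (fun η : ℝ => (∏ i ∈ s, (c i + η)) *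
        (∏ i ∈ Finset.range m, (2 * ((i : ℝ) + 1) + η)) *
          (η * ∫ y, f y * ‖y - x‖ ^ (η - finrank ℝ E) ∂μ)) (𝓝[>] 0)
      (𝓝 ((∏ i ∈ s, c i) * (2 ^ m * m.factorial) *
        (finrank ℝ E * μ.real (Metric.ball 0 1) * f x))) := by
  have hprod : Continuous fun η : ℝ =>
      (∏ i ∈ s, (c i + η)) * ∏ i ∈ Finset.range m, (2 * ((i : ℝ) + 1) + η) := by fun_prop
  have hlim := (hprod.tendsto 0).mono_left (nhdsWithin_le_nhds (s := Set.Ioi 0))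
  simp only [add_zero, prod_range_two_mul_succ] at hlim
  exact hlim.mul (tendsto_mul_integral_norm_sub_rpow μ hf hx)

omit [Nontrivial E] in
lemma hasDerivAt_integral_iterate_laplacian_mul_norm_sub_rpow (hf : ContDiff ℝ (2 * k : ℕ) f)
    (hc : HasCompactSupport f) (x : E) {q : ℝ} (hq : 0 < q) :
    HasDerivAt (fun η : ℝ => ∫ y, (Laplacian.laplacian^[k] f) y * ‖y - x‖ ^ (q + η) ∂μ)
      (∫ y, (Laplacian.laplacian^[k] f) y * (‖y - x‖ ^ q * Real.log ‖y - x‖) ∂μ) 0 := by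
  have h := hasDerivAt_integral_mul_norm_sub_rpow μ
    (contDiff_iterate_laplacian (n := 0) (by rwa [zero_add])).continuous
    (hasCompactSupport_iterate_laplacian hc k) x hq
  rw [← add_zero q] at h
  simpa using h.comp_const_add q 0

lemma integral_iterate_laplacian_mul_norm_sub_rpow_eq (hk : finrank ℝ E < 2 * k)
    (hf : ContDiff ℝ (2 * k : ℕ) f) (hc : HasCompactSupport f) (x : E) :
    ∫ y, (Laplacian.laplacian^[k] f) y * ‖y - x‖ ^ (2 * k - finrank ℝ E : ℝ) ∂μ =
      (∏ i ∈ Finset.range k, (2 * ((i : ℝ) + 1) - finrank ℝ E)) *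
        (2 ^ (k - 1) * (k - 1).factorial) *
          (finrank ℝ E * μ.real (Metric.ball 0 1) * f x) := by
  have hq : (0 : ℝ) < 2 * k - finrank ℝ E := sub_pos.mpr (by exact_mod_cast hk)
  have hlim := ((hasDerivAt_integral_iterate_laplacian_mul_norm_sub_rpow μ hf hc x hq
    ).continuousAt.tendsto.mono_left (nhdsWithin_le_nhds (s := Set.Ioi 0)))
  rw [add_zero] at hlim
  refine tendsto_nhds_unique (hlim.congr' ?_) (tendsto_prod_add_mul_integral_norm_sub_rpow μ _ _ _
    (hf.continuous.integrable_of_hasCompactSupport hc) hf.continuous.continuousAt)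
  filter_upwards [self_mem_nhdsWithin] with η hη
  exact integral_iterate_laplacian_mul_norm_sub_rpow_add μ (by lia) hf hc x hη

lemma integral_iterate_laplacian_mul_norm_sub_rpow_mul_log_eq {a : ℕ}
    (hE : finrank ℝ E = 2 * (a + 1)) (hk : finrank ℝ E < 2 * k)
    (hf : ContDiff ℝ (2 * k : ℕ) f) (hc : HasCompactSupport f) (x : E) :
    ∫ y, (Laplacian.laplacian^[k] f) y *
        (‖y - x‖ ^ (2 * k - finrank ℝ E : ℝ) * Real.log ‖y - x‖) ∂μ =
      (∏ i ∈ (Finset.range k).erase a, (2 * ((i : ℝ) + 1) - finrank ℝ E)) *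
        (2 ^ (k - 1) * (k - 1).factorial) *
          (finrank ℝ E * μ.real (Metric.ball 0 1) * f x) := by
  have hq : (0 : ℝ) < 2 * k - finrank ℝ E := sub_pos.mpr (by exact_mod_cast hk)
  have ha : a ∈ Finset.range k := Finset.mem_range.mpr (by lia)
  have hfactor : 2 * ((a : ℝ) + 1) - finrank ℝ E = 0 := by rw [hE]; push_cast; ring
  have hzero := integral_iterate_laplacian_mul_norm_sub_rpow_eq μ hk hf hc x
  rw [Finset.prod_eq_zero ha hfactor, zero_mul, zero_mul] at hzero
  have hslope := (hasDerivAt_integral_iterate_laplacian_mul_norm_sub_rpow μ hf hc x hq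
    ).tendsto_slope.mono_left
      (nhdsWithin_mono 0 fun η (hη : η ∈ Set.Ioi 0) => ne_of_gt hη)
  refine tendsto_nhds_unique (hslope.congr' ?_)
    (tendsto_prod_add_mul_integral_norm_sub_rpow μ _ _ _
      (hf.continuous.integrable_of_hasCompactSupport hc) hf.continuous.continuousAt)
  filter_upwards [self_mem_nhdsWithin] with η (hη : 0 < η)
  rw [slope_def_field, add_zero, hzero,
    integral_iterate_laplacian_mul_norm_sub_rpow_add μ (by lia) hf hc x hη,
    ← Finset.mul_prod_erase _ _ ha, hfactor, zero_add, sub_zero, sub_zero]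
  field_simp

end FundamentalSolution

section SurfaceSpline

variable {d k : ℕ}

lemma norm_pow_eq_rpow_two_mul_sub_finrank (hk : d < 2 * k) (v : RSpace d) :
    ‖v‖ ^ (2 * k - d) = ‖v‖ ^ (2 * k - finrank ℝ (RSpace d) : ℝ) := by
  rw [finrank_euclideanSpace_fin, ← Real.rpow_natCast, Nat.cast_sub hk.le]
  push_cast
  rfl

variable {f : RSpace d → ℝ}

lemma integral_iteratedLaplacian_mul_const_mul (c : ℝ) (g : RSpace d → ℝ) :
    ∫ y, iteratedLaplacian k f y * (c * g y) = c * ∫ y, (Laplacian.laplacian^[k] f) y * g y := by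
  rw [← integral_const_mul]
  exact integral_congr_ae (.of_forall fun y => mul_left_comm _ _ _)

lemma integral_iteratedLaplacian_mul_surfaceSpline_of_even (hd : 0 < d) (hev : Even d)
    (hk : d < 2 * k) (hf : ContDiff ℝ (2 * k : ℕ) f) (hc : HasCompactSupport f) (x : RSpace d) :
    ∫ y, iteratedLaplacian k f y * surfaceSpline d k (x - y) = f x := by
  obtain ⟨a, rfl⟩ : ∃ a, d = 2 * (a + 1) := by
    obtain ⟨r, rfl⟩ := hev
    exact ⟨r - 1, by lia⟩
  obtain ⟨j, rfl⟩ : ∃ j, k = a + 1 + j := ⟨k - (a + 1), by lia⟩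
  have hhalf : ((2 * (a + 1) : ℕ) : ℝ) / 2 = (a + 1 : ℕ) := by push_cast; ring
  have hball := finrank_mul_volume_real_ball (RSpace (2 * (a + 1)))
  rw [finrank_euclideanSpace_fin, hhalf, Real.rpow_natCast, Nat.cast_succ,
    Real.Gamma_nat_eq_factorial] at hball
  have h := integral_iterate_laplacian_mul_norm_sub_rpow_mul_log_eq volume
    finrank_euclideanSpace_fin (by rwa [finrank_euclideanSpace_fin]) hf hc x
  rw [finrank_euclideanSpace_fin, hball, prod_erase_range_two_mul_sub] at h
  simp only [surfaceSpline, hev, if_true, norm_sub_rev x,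
    norm_pow_eq_rpow_two_mul_sub_finrank hk]
  rw [integral_iteratedLaplacian_mul_const_mul, finrank_euclideanSpace_fin, h,
    show 2 * (a + 1) / 2 = a + 1 by lia, show a + 1 + j - (a + 1) = j by lia,
    show a + 1 + j - 1 = a + j by lia, show a + 1 + j = a + j + 1 by lia]
  have hsign : (-1 : ℝ) ^ a * (-1) ^ a = 1 := by rw [← mul_pow]; norm_num
  have hfour : (4 : ℝ) ^ (a + j + 1) = 4 * (2 ^ (a + j) * 2 ^ (a + j)) := by
    rw [pow_succ', ← mul_pow]
    norm_num
  rw [hfour]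
  field_simp
  linear_combination 4 * f x * hsign

lemma integral_iteratedLaplacian_mul_surfaceSpline_of_odd (hodd : Odd d)
    (hk : d < 2 * k) (hf : ContDiff ℝ (2 * k : ℕ) f) (hc : HasCompactSupport f) (x : RSpace d) :
    ∫ y, iteratedLaplacian k f y * surfaceSpline d k (x - y) = f x := by
  have hd := hodd.pos
  have : NeZero d := ⟨hd.ne'⟩
  have hne (i : ℕ) : (d : ℝ) / 2 ≠ i + 1 := by
    rw [Ne, div_eq_iff two_ne_zero]
    norm_cast
    exact fun h => Nat.not_even_iff_odd.mpr hodd ⟨i + 1, by lia⟩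
  have hΓ := Gamma_sub_natCast_mul_prod (k := k) fun i _ => hne i
  have hΓ0 : Real.Gamma ((d : ℝ) / 2) ≠ 0 := (Real.Gamma_pos_of_pos (by positivity)).ne'
  have hprod := prod_range_two_mul_sub ((d : ℝ) / 2) k
  rw [mul_div_cancel₀ (d : ℝ) two_ne_zero] at hprod
  have h := integral_iterate_laplacian_mul_norm_sub_rpow_eq volume
    (by rwa [finrank_euclideanSpace_fin]) hf hc x
  rw [finrank_mul_volume_real_ball, finrank_euclideanSpace_fin, hprod] at h
  simp only [surfaceSpline, Nat.not_even_iff_odd.mpr hodd, if_false, norm_sub_rev x,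
    norm_pow_eq_rpow_two_mul_sub_finrank hk]
  rw [integral_iteratedLaplacian_mul_const_mul, finrank_euclideanSpace_fin, h]
  have hpow : (-1 : ℝ) ^ k * (-2) ^ k * 2 ^ (k - 1) * 2 = 4 ^ k := by
    rw [mul_assoc, pow_sub_one_mul (by lia), ← mul_pow, ← mul_pow]
    norm_num
  rw [← hpow]
  rw [← hΓ] at hΓ0 ⊢
  have hP := right_ne_zero_of_mul hΓ0
  have hG := left_ne_zero_of_mul hΓ0
  generalize ∏ i ∈ Finset.range k, ((d : ℝ) / 2 - (i + 1)) = P at hP ⊢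
  generalize Real.Gamma ((d : ℝ) / 2 - k) = G at hG ⊢
  field_simp

lemma integral_iteratedLaplacian_mul_surfaceSpline (hd : 0 < d) (hk : d < 2 * k)
    (hf : ContDiff ℝ (2 * k : ℕ) f) (hc : HasCompactSupport f) (x : RSpace d) :
    ∫ y, iteratedLaplacian k f y * surfaceSpline d k (x - y) = f x :=
  (Nat.even_or_odd d).elim
    (fun h => integral_iteratedLaplacian_mul_surfaceSpline_of_even hd h hk hf hc x)
    (fun h => integral_iteratedLaplacian_mul_surfaceSpline_of_odd h hk hf hc x)

end SurfaceSpline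

/-! ### Local reproduction of polynomials -/

section PolynomialFunctions

/-- The space of polynomial functions on `ℝ^d` of total degree at most `n`, the functions which a
local polynomial reproduction of order greater than `n` reproduces. -/
noncomputable def polyFunctions (d n : ℕ) : Submodule ℝ (RSpace d → ℝ) :=
  (MvPolynomial.restrictTotalDegree (Fin d) ℝ n).map
    (MvPolynomial.aeval fun i (v : RSpace d) => v i).toLinearMap

variable {d m n : ℕ} {g h : RSpace d → ℝ}

lemma mem_polyFunctions : g ∈ polyFunctions d n ↔ ∃ p : MvPolynomial (Fin d) ℝ,
    p.totalDegree ≤ n ∧ MvPolynomial.aeval (fun i (v : RSpace d) => v i) p = g := by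
  simp [polyFunctions, MvPolynomial.mem_restrictTotalDegree]

lemma aeval_coord_apply (p : MvPolynomial (Fin d) ℝ) (v : RSpace d) :
    MvPolynomial.aeval (fun i (v : RSpace d) => v i) p v = MvPolynomial.eval (fun i => v i) p := by
  induction p using MvPolynomial.induction_on <;> simp_all

lemma polyFunctions_mono (hmn : m ≤ n) : polyFunctions d m ≤ polyFunctions d n :=
  Submodule.map_mono fun p hp => by
    rw [MvPolynomial.mem_restrictTotalDegree] at hp ⊢
    exact hp.trans hmn

lemma const_mem_polyFunctions (c : ℝ) : (fun _ => c) ∈ polyFunctions d n :=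
  mem_polyFunctions.mpr ⟨.C c, by simp, by ext; simp⟩

lemma coord_mem_polyFunctions (i : Fin d) : (fun v => v i) ∈ polyFunctions d 1 :=
  mem_polyFunctions.mpr ⟨.X i, by simp, by simp⟩

lemma mul_mem_polyFunctions (hg : g ∈ polyFunctions d m) (hh : h ∈ polyFunctions d n) :
    (fun v => g v * h v) ∈ polyFunctions d (m + n) := by
  obtain ⟨p, hp, rfl⟩ := mem_polyFunctions.mp hg
  obtain ⟨q, hq, rfl⟩ := mem_polyFunctions.mp hh
  exact mem_polyFunctions.mpr
    ⟨p * q, (MvPolynomial.totalDegree_mul _ _).trans (add_le_add hp hq), map_mul _ _ _⟩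

lemma prod_mem_polyFunctions {ι : Type*} (s : Finset ι) {g : ι → RSpace d → ℝ}
    (hg : ∀ i ∈ s, g i ∈ polyFunctions d n) :
    (fun v => ∏ i ∈ s, g i v) ∈ polyFunctions d (s.card * n) := by
  classical
  induction s using Finset.induction_on with
  | empty => simpa using const_mem_polyFunctions 1
  | insert i s hi ih =>
    simp only [Finset.prod_insert hi, Finset.card_insert_of_notMem hi, Nat.add_one_mul,
      add_comm _ n]
    exact mul_mem_polyFunctions (hg i (s.mem_insert_self i))
      (ih fun j hj => hg j (Finset.mem_insert_of_mem hj))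

lemma sum_fun_mem_polyFunctions {ι : Type*} (s : Finset ι) {g : ι → RSpace d → ℝ}
    (hg : ∀ i ∈ s, g i ∈ polyFunctions d n) : (fun v => ∑ i ∈ s, g i v) ∈ polyFunctions d n := by
  simpa only [Finset.sum_fn] using sum_mem hg

lemma norm_sub_pow_mem_polyFunctions (hm : Even m) (x : RSpace d) :
    (fun v => ‖x - v‖ ^ m) ∈ polyFunctions d m := by
  obtain ⟨j, rfl⟩ := hm.two_dvd
  have hsq : (fun v => ‖x - v‖ ^ 2) ∈ polyFunctions d 2 := by
    have hnorm : (fun v => ‖x - v‖ ^ 2) = fun v => ∑ i, (x i - v i) * (x i - v i) := by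
      ext v
      rw [EuclideanSpace.real_norm_sq_eq]
      simp only [PiLp.sub_apply, sq]
    have hcoord (i : Fin d) : (fun v => x i - v i) ∈ polyFunctions d 1 :=
      sub_mem (const_mem_polyFunctions (x i)) (coord_mem_polyFunctions i)
    rw [hnorm]
    exact sum_fun_mem_polyFunctions _ fun i _ =>
      mul_mem_polyFunctions (m := 1) (n := 1) (hcoord i) (hcoord i)
  simpa [pow_mul, mul_comm j] using prod_mem_polyFunctions (Finset.range j) fun _ _ => hsq

lemma linearMap_mem_polyFunctions (L : RSpace d →ₗ[ℝ] ℝ) : ⇑L ∈ polyFunctions d 1 := by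
  have hL : ⇑L = fun v => ∑ i, L (EuclideanSpace.single i 1) * v i := by
    ext v
    conv_lhs => rw [← (EuclideanSpace.basisFun (Fin d) ℝ).sum_repr v]
    simp [mul_comm]
  rw [hL]
  exact sum_fun_mem_polyFunctions _ fun i _ => Submodule.smul_mem _ _ (coord_mem_polyFunctions i)

lemma affineMap_mem_polyFunctions (A : RSpace d →ᵃ[ℝ] ℝ) : ⇑A ∈ polyFunctions d 1 := by
  rw [A.decomp]
  exact add_mem (linearMap_mem_polyFunctions A.linear) (const_mem_polyFunctions (A 0))

lemma multilinearMap_comp_affineMap_mem_polyFunctions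
    (M : MultilinearMap ℝ (fun _ : Fin m => RSpace d) ℝ) (A : RSpace d →ᵃ[ℝ] RSpace d) :
    (fun v => M fun _ => A v) ∈ polyFunctions d m := by
  have hM (v : RSpace d) : (M fun _ => A v) = ∑ r : Fin m → Fin d,
      (M fun i => EuclideanSpace.single (r i) 1) * ∏ i, A v (r i) := by
    have hv : A v = ∑ i, A v i • EuclideanSpace.single i (1 : ℝ) := by
      simpa using ((EuclideanSpace.basisFun (Fin d) ℝ).sum_repr (A v)).symm
    conv_lhs => rw [hv, M.map_sum]
    simp only [M.map_smul_univ, smul_eq_mul, mul_comm]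
  have hA (i : Fin d) : (fun v => A v i) ∈ polyFunctions d 1 :=
    affineMap_mem_polyFunctions ((EuclideanSpace.proj (𝕜 := ℝ) i).toLinearMap.toAffineMap.comp A)
  simp_rw [hM]
  refine sum_fun_mem_polyFunctions _ fun r _ => Submodule.smul_mem _ _ ?_
  simpa using prod_mem_polyFunctions Finset.univ fun i _ => hA (r i)

end PolynomialFunctions

section LocalDensity

variable {d n ℓ : ℕ} {Ξ : Set (RSpace d)} {ρ : RSpace d → ℝ} {a : Ξ → RSpace d → ℝ} {K B : ℝ}
  {g P : RSpace d → ℝ}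

lemma IsLocalDensity.hasSum_mul_of_mem_polyFunctions (h : IsLocalDensity Ξ ρ a ℓ K) (hn : n < ℓ)
    (hP : P ∈ polyFunctions d n) (α : RSpace d) : HasSum (fun ξ : Ξ => a ξ α * P ξ) (P α) := by
  obtain ⟨p, hp, rfl⟩ := mem_polyFunctions.mp hP
  simpa only [aeval_coord_apply] using h.precision p (hp.trans_lt hn) α

lemma IsLocalDensity.norm_mul_le (h : IsLocalDensity Ξ ρ a ℓ K) {α : RSpace d}
    (hg : ∀ ξ ∈ Metric.closedBall α (ρ α), |g ξ| ≤ B) (ξ : Ξ) :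
    ‖a ξ α * g ξ‖ ≤ |a ξ α| * B := by
  rw [norm_mul, Real.norm_eq_abs, Real.norm_eq_abs]
  by_cases hξ : ‖(ξ : RSpace d) - α‖ ≤ ρ α
  · exact mul_le_mul_of_nonneg_left (hg ξ (mem_closedBall_iff_norm.mpr hξ)) (abs_nonneg _)
  · simp [h.support ξ α (not_le.mp hξ)]

lemma IsLocalDensity.abs_tsum_mul_le (h : IsLocalDensity Ξ ρ a ℓ K) {α : RSpace d}
    (hg : ∀ ξ ∈ Metric.closedBall α (ρ α), |g ξ| ≤ B) :
    |∑' ξ : Ξ, a ξ α * g ξ| ≤ K * B := by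
  have hB : 0 ≤ B := (abs_nonneg _).trans (hg α (Metric.mem_closedBall_self (h.pos α).le))
  calc |∑' ξ : Ξ, a ξ α * g ξ| ≤ ∑' ξ : Ξ, |a ξ α| * B :=
        tsum_of_norm_bounded ((h.summable α).mul_right B).hasSum (h.norm_mul_le hg)
    _ = (∑' ξ : Ξ, |a ξ α|) * B := tsum_mul_right
    _ ≤ K * B := mul_le_mul_of_nonneg_right (h.stability α).le hB

lemma IsLocalDensity.summable_mul (h : IsLocalDensity Ξ ρ a ℓ K) (hg : Continuous g)
    (α : RSpace d) : Summable fun ξ : Ξ => a ξ α * g ξ := by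
  obtain ⟨B, hB⟩ := (isCompact_closedBall α (ρ α)).exists_bound_of_continuousOn hg.continuousOn
  exact .of_norm_bounded ((h.summable α).mul_right B) (h.norm_mul_le hB)

lemma IsLocalDensity.abs_tsum_mul_sub_le (h : IsLocalDensity Ξ ρ a ℓ K) (hg : Continuous g)
    (hn : n < ℓ) (hP : P ∈ polyFunctions d n) {α : RSpace d}
    (hB : ∀ ξ ∈ Metric.closedBall α (ρ α), |g ξ - P ξ| ≤ B) :
    |∑' ξ : Ξ, a ξ α * g ξ - g α| ≤ (K + 1) * B := by
  have hsum := (h.summable_mul hg α).hasSum.sub (h.hasSum_mul_of_mem_polyFunctions hn hP α)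
  simp_rw [← mul_sub] at hsum
  calc |∑' ξ : Ξ, a ξ α * g ξ - g α|
      = |∑' ξ : Ξ, a ξ α * (g ξ - P ξ) - (g α - P α)| := by rw [hsum.tsum_eq]; ring_nf
    _ ≤ |∑' ξ : Ξ, a ξ α * (g ξ - P ξ)| + |g α - P α| := abs_sub _ _
    _ ≤ K * B + B := add_le_add (h.abs_tsum_mul_le (g := fun ξ => g ξ - P ξ) hB)
        (hB α (Metric.mem_closedBall_self (h.pos α).le))
    _ = (K + 1) * B := by ring

end LocalDensity

section SurfaceSpline

variable {d k : ℕ}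

lemma continuous_surfaceSpline (hk : d < 2 * k) : Continuous (surfaceSpline d k) := by
  unfold surfaceSpline
  split_ifs
  · have hlog (x : RSpace d) : ‖x‖ ^ (2 * k - d) * Real.log ‖x‖ =
        ‖x‖ ^ (2 * k - d - 1) * (‖x‖ * Real.log ‖x‖) := by
      rw [← mul_assoc, pow_sub_one_mul (Nat.sub_pos_of_lt hk).ne']
    simp_rw [hlog]
    have := Real.continuous_mul_log
    fun_prop
  · fun_prop

lemma continuous_surfaceSpline_sub (hk : d < 2 * k) (x : RSpace d) :
    Continuous fun ξ => surfaceSpline d k (x - ξ) :=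
  (continuous_surfaceSpline hk).comp (by fun_prop)

lemma analyticAt_surfaceSpline {u : RSpace d} (hu : u ≠ 0) :
    AnalyticAt ℝ (surfaceSpline d k) u := by
  have hnorm : AnalyticAt ℝ (fun x : RSpace d => ‖x‖) u := (contDiffAt_norm ℝ hu).analyticAt
  have hlog := (analyticAt_log (norm_pos_iff.mpr hu)).comp hnorm
  unfold surfaceSpline
  split_ifs
  · exact analyticAt_const.mul ((hnorm.pow _).mul hlog)
  · exact analyticAt_const.mul (hnorm.pow _)

lemma surfaceSpline_eq_of_norm_eq {u v : RSpace d} (h : ‖u‖ = ‖v‖) :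
    surfaceSpline d k u = surfaceSpline d k v := by
  simp only [surfaceSpline, h]

lemma exists_surfaceSpline_smul_eq (hk : d < 2 * k) {R : ℝ} (hR : 0 < R) :
    ∃ c : ℝ, (c = 0 ∨ Even (2 * k - d)) ∧ ∀ z : RSpace d,
      surfaceSpline d k (R • z) =
        R ^ (2 * k - d) * surfaceSpline d k z + c * ‖z‖ ^ (2 * k - d) := by
  unfold surfaceSpline
  split_ifs with hd
  · set A : ℝ := (-1) ^ (d / 2 + 1) * 2 / (4 ^ k * Real.pi ^ (d / 2) *
      (Nat.factorial (k - 1) : ℝ) * (Nat.factorial (k - d / 2) : ℝ))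
    have heven : Even (2 * k - d) := (Nat.even_sub hk.le).mpr (by simp [hd])
    refine ⟨A * R ^ (2 * k - d) * Real.log R, .inr heven, fun z => ?_⟩
    rw [norm_smul, Real.norm_of_nonneg hR.le]
    rcases (norm_nonneg z).eq_or_lt with hz | hz
    · rw [← hz, mul_zero, zero_pow (Nat.sub_pos_of_lt hk).ne']
      simp
    · rw [Real.log_mul hR.ne' hz.ne', mul_pow]
      ring
  · refine ⟨0, .inl rfl, fun z => ?_⟩
    rw [norm_smul, Real.norm_of_nonneg hR.le, mul_pow]
    ring

lemma exists_surfaceSpline_sub_eq (hk : d < 2 * k) {R : ℝ} (hR : 0 < R) (x : RSpace d) :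
    ∃ q ∈ polyFunctions d (2 * k - d), ∀ ξ : RSpace d,
      surfaceSpline d k (x - ξ) =
        R ^ (2 * k - d) * surfaceSpline d k (R⁻¹ • (x - ξ)) + q ξ := by
  obtain ⟨c, hc, hφ⟩ := exists_surfaceSpline_smul_eq hk hR
  refine ⟨(c * R⁻¹ ^ (2 * k - d)) • fun ξ => ‖x - ξ‖ ^ (2 * k - d), ?_, fun ξ => ?_⟩
  · rcases hc with rfl | hc
    · simp
    · exact Submodule.smul_mem _ _ (norm_sub_pow_mem_polyFunctions hc x)
  · have h := hφ (R⁻¹ • (x - ξ))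
    rw [smul_inv_smul₀ hR.ne', norm_smul, Real.norm_of_nonneg (inv_nonneg.mpr hR.le), mul_pow,
      ← mul_assoc] at h
    exact h

/- The Taylor polynomial at one unit vector serves them all: the surface spline is radial, and a
reflection carries any unit vector to the chosen one. -/
lemma exists_abs_surfaceSpline_add_sub_le (hd : 0 < d) (ℓ : ℕ) :
    ∃ δ > 0, ∃ C > 0, ∀ u : RSpace d, ‖u‖ = 1 → ∃ P : RSpace d → ℝ,
      (∀ A : RSpace d →ᵃ[ℝ] RSpace d, P ∘ A ∈ polyFunctions d (ℓ - 1)) ∧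
      ∀ v, ‖v‖ ≤ δ → |surfaceSpline d k (u + v) - P v| ≤ C * ‖v‖ ^ ℓ := by
  set e : RSpace d := EuclideanSpace.single ⟨0, hd⟩ 1 with he
  have he1 : ‖e‖ = 1 := by simp [he]
  obtain ⟨p, hp⟩ := analyticAt_surfaceSpline (k := k) (norm_ne_zero_iff.mp (he1 ▸ one_ne_zero))
  obtain ⟨C, hC, hO⟩ := (hp.isBigO_sub_partialSum_pow ℓ).exists_pos
  obtain ⟨δ, hδ, hball⟩ := Metric.eventually_nhds_iff_ball.mp hO.bound
  refine ⟨δ / 2, half_pos hδ, C, hC, fun u hu => ?_⟩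
  obtain ⟨Q, hQ⟩ : ∃ Q : RSpace d ≃ₗᵢ[ℝ] RSpace d, Q u = e :=
    ⟨_, Submodule.reflection_sub (hu.trans he1.symm)⟩
  refine ⟨fun v => p.partialSum ℓ (Q v), fun A => ?_, fun v hv => ?_⟩
  · have hterm (j : ℕ) (hj : j ∈ Finset.range ℓ) :
        (fun v => p j fun _ => Q (A v)) ∈ polyFunctions d (ℓ - 1) :=
      polyFunctions_mono (Nat.le_sub_one_of_lt (Finset.mem_range.mp hj))
        (multilinearMap_comp_affineMap_mem_polyFunctions (p j).toMultilinearMap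
          (Q.toLinearEquiv.toLinearMap.toAffineMap.comp A))
    exact sum_fun_mem_polyFunctions _ hterm
  · have hTaylor := hball (Q v) (by rw [mem_ball_zero_iff, Q.norm_map]; linarith)
    rw [norm_pow, norm_norm, Q.norm_map, Real.norm_eq_abs] at hTaylor
    rwa [surfaceSpline_eq_of_norm_eq (v := e + Q v) (by rw [← hQ, ← map_add, Q.norm_map])]

end SurfaceSpline

section KernelError

variable {d k ℓ : ℕ} {Ξ : Set (RSpace d)} {ρ : RSpace d → ℝ} {a : Ξ → RSpace d → ℝ} {K : ℝ}

lemma IsLocalDensity.abs_splineKernel_sub_le (h : IsLocalDensity Ξ ρ a ℓ K) (hk : d < 2 * k)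
    (hℓ : 2 * k - d < ℓ) {P : RSpace d → ℝ} (hP : P ∈ polyFunctions d (ℓ - 1)) {R B : ℝ}
    (hR : 0 < R) {x α : RSpace d}
    (hB : ∀ ξ ∈ Metric.closedBall α (ρ α), |surfaceSpline d k (R⁻¹ • (x - ξ)) - P ξ| ≤ B) :
    |splineKernel k a x α - surfaceSpline d k (x - α)| ≤ (K + 1) * (R ^ (2 * k - d) * B) := by
  obtain ⟨q, hq, hφ⟩ := exists_surfaceSpline_sub_eq hk hR x
  refine h.abs_tsum_mul_sub_le (continuous_surfaceSpline_sub hk x)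
    (Nat.sub_one_lt_of_lt hℓ) (add_mem (Submodule.smul_mem _ (R ^ (2 * k - d)) hP)
      (polyFunctions_mono (Nat.le_sub_one_of_lt hℓ) hq)) fun ξ hξ => ?_
  rw [hφ, Pi.add_apply, Pi.smul_apply, smul_eq_mul, add_sub_add_right_eq_sub, ← mul_sub, abs_mul,
    abs_of_nonneg (by positivity)]
  exact mul_le_mul_of_nonneg_left (hB ξ hξ) (by positivity)

lemma exists_abs_splineKernel_sub_le_of_norm_sub_le (hk : d < 2 * k) (hℓ : 2 * k - d < ℓ)
    (M N : ℝ) :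
    ∃ B ≥ 0, ∀ (Ξ : Set (RSpace d)) (ρ : RSpace d → ℝ) (a : Ξ → RSpace d → ℝ),
      IsLocalDensity Ξ ρ a ℓ K → ∀ (x α : RSpace d) (R : ℝ), 0 < R → ‖x - α‖ ≤ M * R →
        ρ α ≤ N * R →
          |splineKernel k a x α - surfaceSpline d k (x - α)| ≤ (K + 1) * (R ^ (2 * k - d) * B) := by
  obtain ⟨B, hB⟩ := (isCompact_closedBall (0 : RSpace d) (M + N)).exists_bound_of_continuousOn
    (continuous_surfaceSpline hk).continuousOn
  refine ⟨max B 0, le_max_right _ _, fun Ξ ρ a h x α R hR hx hα => ?_⟩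
  refine h.abs_splineKernel_sub_le hk hℓ (zero_mem _) hR fun ξ hξ => ?_
  have hnorm : ‖x - ξ‖ ≤ R * (M + N) := calc
    ‖x - ξ‖ ≤ ‖x - α‖ + ‖α - ξ‖ := norm_sub_le_norm_sub_add_norm_sub _ _ _
    _ ≤ M * R + N * R := add_le_add hx ((mem_closedBall_iff_norm'.mp hξ).trans hα)
    _ = R * (M + N) := by ring
  have hmem : R⁻¹ • (x - ξ) ∈ Metric.closedBall 0 (M + N) := by
    rwa [mem_closedBall_zero_iff, norm_smul, Real.norm_of_nonneg (inv_nonneg.mpr hR.le),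
      inv_mul_le_iff₀ hR]
  simpa using (hB _ hmem).trans (le_max_left B 0)

lemma exists_abs_splineKernel_sub_le_of_div_le (hd : 0 < d) (hk : d < 2 * k)
    (hℓ : 2 * k - d < ℓ) :
    ∃ δ > 0, ∃ C > 0, ∀ (Ξ : Set (RSpace d)) (ρ : RSpace d → ℝ) (a : Ξ → RSpace d → ℝ),
      IsLocalDensity Ξ ρ a ℓ K → ∀ x α : RSpace d, 0 < ‖x - α‖ → ρ α / ‖x - α‖ ≤ δ →
        |splineKernel k a x α - surfaceSpline d k (x - α)| ≤
          (K + 1) * (‖x - α‖ ^ (2 * k - d) * (C * (ρ α / ‖x - α‖) ^ ℓ)) := by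
  obtain ⟨δ, hδ, C, hC, hexp⟩ := exists_abs_surfaceSpline_add_sub_le (k := k) hd ℓ
  refine ⟨δ, hδ, C, hC, fun Ξ ρ a h x α hx hα => ?_⟩
  set t := ‖x - α‖
  obtain ⟨P, hP, hPle⟩ := hexp (t⁻¹ • (x - α)) (norm_smul_inv_norm (norm_pos_iff.mp hx))
  refine h.abs_splineKernel_sub_le hk hℓ
    (hP (t⁻¹ • (AffineMap.const ℝ _ α - AffineMap.id ℝ _))) hx fun ξ hξ => ?_
  have hnorm : ‖t⁻¹ • (α - ξ)‖ ≤ ρ α / t := by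
    rw [norm_smul, Real.norm_of_nonneg (inv_nonneg.mpr hx.le), div_eq_inv_mul]
    exact mul_le_mul_of_nonneg_left (mem_closedBall_iff_norm'.mp hξ) (inv_nonneg.mpr hx.le)
  calc |surfaceSpline d k (t⁻¹ • (x - ξ)) - P (t⁻¹ • (α - ξ))|
      = |surfaceSpline d k (t⁻¹ • (x - α) + t⁻¹ • (α - ξ)) - P (t⁻¹ • (α - ξ))| := by
        rw [← smul_add, sub_add_sub_cancel]
    _ ≤ C * ‖t⁻¹ • (α - ξ)‖ ^ ℓ := hPle _ (hnorm.trans hα)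
    _ ≤ C * (ρ α / t) ^ ℓ := by gcongr

end KernelError

/-! ### Approximation under slow growth -/

section Decay

variable {d k ℓ : ℕ} {ρ : RSpace d → ℝ} {ε Csg K : ℝ}

lemma SlowGrowth.le_of_norm_sub_le (h : SlowGrowth ρ ε Csg) (hCsg : 0 ≤ Csg) {M : ℝ}
    {x α : RSpace d} (hx : 0 < ρ x) (hM : ‖x - α‖ ≤ M * ρ x) :
    ρ α ≤ Csg * (1 + M) ^ |1 - ε| * ρ x := by
  have hs : 0 ≤ ‖x - α‖ / ρ x := by positivity
  have hpow : (1 + ‖x - α‖ / ρ x) ^ (1 - ε) ≤ (1 + M) ^ |1 - ε| := calc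
    (1 + ‖x - α‖ / ρ x) ^ (1 - ε) ≤ (1 + ‖x - α‖ / ρ x) ^ |1 - ε| :=
      Real.rpow_le_rpow_of_exponent_le (by linarith) (le_abs_self _)
    _ ≤ (1 + M) ^ |1 - ε| := by
      gcongr
      exact (div_le_iff₀ hx).mpr hM
  calc ρ α ≤ Csg * ρ x * (1 + ‖x - α‖ / ρ x) ^ (1 - ε) := h x α
    _ ≤ Csg * ρ x * (1 + M) ^ |1 - ε| := by gcongr
    _ = Csg * (1 + M) ^ |1 - ε| * ρ x := by ring

lemma SlowGrowth.div_norm_sub_le (h : SlowGrowth ρ ε Csg) (hCsg : 0 ≤ Csg) {x α : RSpace d}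
    (hx : 0 < ρ x) (hα : ρ x ≤ ‖x - α‖) :
    ρ α / ‖x - α‖ ≤ 2 * Csg * (1 + ‖x - α‖ / ρ x) ^ (-ε) := by
  have hpos : 0 < ‖x - α‖ := hx.trans_le hα
  rw [div_le_iff₀ hpos]
  calc ρ α ≤ Csg * ρ x * (1 + ‖x - α‖ / ρ x) ^ (1 - ε) := h x α
    _ = Csg * (1 + ‖x - α‖ / ρ x) ^ (-ε) * (ρ x + ‖x - α‖) := by
      rw [sub_eq_add_neg 1 ε, Real.rpow_add (by positivity), Real.rpow_one]
      field_simp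
    _ ≤ Csg * (1 + ‖x - α‖ / ρ x) ^ (-ε) * (2 * ‖x - α‖) := by
      gcongr
      linarith
    _ = 2 * Csg * (1 + ‖x - α‖ / ρ x) ^ (-ε) * ‖x - α‖ := by ring

lemma exists_near_abs_splineKernel_sub_le_mul_rpow (hk : d < 2 * k) (hℓ : 2 * k - d < ℓ)
    (hK : 0 ≤ K) (hCsg : 0 ≤ Csg) {M p : ℝ} (hM : 0 ≤ M) (hp : 0 ≤ p) :
    ∃ C ≥ 0, ∀ (Ξ : Set (RSpace d)) (ρ : RSpace d → ℝ) (a : Ξ → RSpace d → ℝ),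
      IsLocalDensity Ξ ρ a ℓ K → SlowGrowth ρ ε Csg → ∀ x α : RSpace d, ‖x - α‖ ≤ M * ρ x →
        |splineKernel k a x α - surfaceSpline d k (x - α)| ≤
          C * ρ x ^ (2 * k - d) * (1 + ‖x - α‖ / ρ x) ^ (-p) := by
  obtain ⟨B, hB0, hB⟩ := exists_abs_splineKernel_sub_le_of_norm_sub_le (K := K) hk hℓ M
    (Csg * (1 + M) ^ |1 - ε|)
  refine ⟨(K + 1) * B * (1 + M) ^ p, by positivity, fun Ξ ρ a h hsg x α hα => ?_⟩
  have hx := h.pos x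
  have hone : 1 ≤ (1 + M) ^ p * (1 + ‖x - α‖ / ρ x) ^ (-p) := by
    rw [Real.rpow_neg (by positivity), ← div_eq_mul_inv, one_le_div (by positivity)]
    gcongr
    exact (div_le_iff₀ hx).mpr hα
  calc |splineKernel k a x α - surfaceSpline d k (x - α)|
      ≤ (K + 1) * (ρ x ^ (2 * k - d) * B) :=
        hB Ξ ρ a h x α (ρ x) hx hα (hsg.le_of_norm_sub_le hCsg hx hα)
    _ ≤ (K + 1) * (ρ x ^ (2 * k - d) * B) * ((1 + M) ^ p * (1 + ‖x - α‖ / ρ x) ^ (-p)) :=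
        le_mul_of_one_le_right (by positivity) hone
    _ = _ := by ring

lemma exists_forall_ge_mul_rpow_neg_le (hε : 0 < ε) (A : ℝ) {δ : ℝ} (hδ : 0 < δ) :
    ∃ M ≥ 1, ∀ s ≥ M, A * (1 + s) ^ (-ε) ≤ δ := by
  have hlim : Tendsto (fun s : ℝ => A * (1 + s) ^ (-ε)) atTop (𝓝 (A * 0)) :=
    ((tendsto_rpow_neg_atTop hε).comp (tendsto_atTop_add_const_left _ 1 tendsto_id)).const_mul _
  rw [mul_zero] at hlim
  obtain ⟨M, hM⟩ := eventually_atTop.mp (hlim.eventually_le_const hδ)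
  exact ⟨max 1 M, le_max_left _ _, fun s hs => hM s ((le_max_right _ _).trans hs)⟩

lemma exists_far_abs_splineKernel_sub_le_mul_rpow (hd : 0 < d) (hk : d < 2 * k)
    (hℓ : 2 * k - d < ℓ) (hε : 0 < ε) (hK : 0 ≤ K) (hCsg : 0 ≤ Csg) :
    ∃ M ≥ 0, ∃ C ≥ 0, ∀ (Ξ : Set (RSpace d)) (ρ : RSpace d → ℝ) (a : Ξ → RSpace d → ℝ),
      IsLocalDensity Ξ ρ a ℓ K → SlowGrowth ρ ε Csg → ∀ x α : RSpace d, M * ρ x ≤ ‖x - α‖ →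
        |splineKernel k a x α - surfaceSpline d k (x - α)| ≤
          C * ρ x ^ (2 * k - d) * (1 + ‖x - α‖ / ρ x) ^ (-(ε * ℓ + d - 2 * k)) := by
  obtain ⟨δ, hδ, C, hC, hfar⟩ := exists_abs_splineKernel_sub_le_of_div_le (K := K) hd hk hℓ
  obtain ⟨M, hM1, hM⟩ := exists_forall_ge_mul_rpow_neg_le hε (2 * Csg) hδ
  refine ⟨M, by positivity, (K + 1) * (C * (2 * Csg) ^ ℓ), by positivity,
    fun Ξ ρ a h hsg x α hα => ?_⟩
  have hx := h.pos x
  have hle : ρ x ≤ ‖x - α‖ := (le_mul_of_one_le_left hx.le hM1).trans hα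
  have hpos : 0 < ‖x - α‖ := hx.trans_le hle
  have hquot := hsg.div_norm_sub_le hCsg hx hle
  have hquot0 : 0 ≤ ρ α / ‖x - α‖ := div_nonneg (h.pos α).le hpos.le
  have hδle := hquot.trans (hM _ ((le_div_iff₀ hx).mpr hα))
  have hnorm : ‖x - α‖ ≤ (1 + ‖x - α‖ / ρ x) * ρ x := by
    rw [add_mul, div_mul_cancel₀ _ hx.ne']
    linarith
  have hs : 0 < 1 + ‖x - α‖ / ρ x := by positivity
  generalize 1 + ‖x - α‖ / ρ x = s at *
  have hexp : s ^ (2 * k - d) * (s ^ (-ε)) ^ ℓ = s ^ (-(ε * ℓ + d - 2 * k)) := by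
    rw [← Real.rpow_natCast, ← Real.rpow_natCast, ← Real.rpow_mul hs.le, ← Real.rpow_add hs]
    push_cast [Nat.cast_sub hk.le]
    ring_nf
  calc |splineKernel k a x α - surfaceSpline d k (x - α)|
      ≤ (K + 1) * (‖x - α‖ ^ (2 * k - d) * (C * (ρ α / ‖x - α‖) ^ ℓ)) :=
        hfar Ξ ρ a h x α hpos hδle
    _ ≤ (K + 1) * ((s * ρ x) ^ (2 * k - d) * (C * (2 * Csg * s ^ (-ε)) ^ ℓ)) := by gcongr
    _ = (K + 1) * (C * (2 * Csg) ^ ℓ) * ρ x ^ (2 * k - d) *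
          (s ^ (2 * k - d) * (s ^ (-ε)) ^ ℓ) := by ring
    _ = _ := by rw [hexp]

lemma exists_abs_splineKernel_sub_le_mul_rpow (hd : 0 < d) (hk : d < 2 * k)
    (hℓ : 2 * k - d < ℓ) (hε : 2 * k < ε * ℓ) (hK : 0 ≤ K) (hCsg : 0 ≤ Csg) :
    ∃ C ≥ 0, ∀ (Ξ : Set (RSpace d)) (ρ : RSpace d → ℝ) (a : Ξ → RSpace d → ℝ),
      IsLocalDensity Ξ ρ a ℓ K → SlowGrowth ρ ε Csg → ∀ x α : RSpace d,
        |splineKernel k a x α - surfaceSpline d k (x - α)| ≤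
          C * ρ x ^ (2 * k - d) * (1 + ‖x - α‖ / ρ x) ^ (-(ε * ℓ + d - 2 * k)) := by
  have hε0 : 0 < ε := pos_of_mul_pos_left ((by positivity : (0 : ℝ) ≤ 2 * k).trans_lt hε)
    ℓ.cast_nonneg
  have hp : 0 ≤ ε * ℓ + d - 2 * k := by
    have : (0 : ℝ) ≤ d := d.cast_nonneg
    linarith
  obtain ⟨M, hM, C₁, hC₁, hfar⟩ :=
    exists_far_abs_splineKernel_sub_le_mul_rpow (K := K) (Csg := Csg) hd hk hℓ hε0 hK hCsg
  obtain ⟨C₂, _, hnear⟩ :=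
    exists_near_abs_splineKernel_sub_le_mul_rpow (ε := ε) hk hℓ hK hCsg hM hp
  refine ⟨max C₁ C₂, le_max_of_le_left hC₁, fun Ξ ρ a h hsg x α => ?_⟩
  have hx := h.pos x
  rcases le_total (M * ρ x) ‖x - α‖ with hα | hα
  · refine (hfar Ξ ρ a h hsg x α hα).trans ?_
    gcongr
    exact le_max_left _ _
  · refine (hnear Ξ ρ a h hsg x α hα).trans ?_
    gcongr
    exact le_max_right _ _

end Decay

section Rescaling

variable {E : Type*} [NormedAddCommGroup E] [NormedSpace ℝ E] [FiniteDimensional ℝ E]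
  [MeasurableSpace E] [BorelSpace E] (μ : Measure E) [μ.IsAddHaarMeasure] {p R : ℝ}

lemma integrable_one_add_norm_sub_div_rpow (hp : finrank ℝ E < p) (hR : 0 < R) (x : E) :
    Integrable (fun y : E => (1 + ‖x - y‖ / R) ^ (-p)) μ := by
  have h := (((integrable_one_add_norm (μ := μ) hp).comp_smul (inv_ne_zero hR.ne')).comp_sub_left x)
  simpa only [norm_smul, Real.norm_of_nonneg (inv_nonneg.mpr hR.le), ← div_eq_inv_mul] using h

lemma integral_one_add_norm_sub_div_rpow (p : ℝ) (hR : 0 < R) (x : E) :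
    ∫ y, (1 + ‖x - y‖ / R) ^ (-p) ∂μ = R ^ finrank ℝ E * ∫ z, (1 + ‖z‖) ^ (-p) ∂μ := by
  have h := Measure.integral_comp_inv_smul_of_nonneg μ (fun z : E => (1 + ‖z‖) ^ (-p)) hR.le
  simp only [norm_smul, Real.norm_of_nonneg (inv_nonneg.mpr hR.le), ← div_eq_inv_mul,
    smul_eq_mul] at h
  rw [← h]
  exact integral_sub_left_eq_self (fun z => (1 + ‖z‖ / R) ^ (-p)) μ x

end Rescaling

section Approximation

variable {d k ℓ : ℕ} {ε Csg K : ℝ}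

lemma continuous_iteratedLaplacian {f : RSpace d → ℝ} (hf : ContDiff ℝ (2 * k : ℕ) f) :
    Continuous (iteratedLaplacian k f) :=
  (contDiff_iterate_laplacian (n := 0) (by rwa [zero_add])).continuous

lemma hasCompactSupport_iteratedLaplacian {f : RSpace d → ℝ} (hc : HasCompactSupport f) (k : ℕ) :
    HasCompactSupport (iteratedLaplacian k f) :=
  hasCompactSupport_iterate_laplacian hc k

lemma exists_abs_integral_mul_splineKernel_sub_le (hd : 0 < d) (hk : d < 2 * k)
    (hℓ : 2 * k - d < ℓ) (hε : 2 * k < ε * ℓ) (hK : 0 ≤ K) (hCsg : 0 ≤ Csg) :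
    ∃ C > 0, ∀ (Ξ : Set (RSpace d)) (ρ : RSpace d → ℝ) (a : Ξ → RSpace d → ℝ),
      IsLocalDensity Ξ ρ a ℓ K → SlowGrowth ρ ε Csg → ∀ x : RSpace d,
        AEStronglyMeasurable (splineKernel k a x) →
        ∀ (g : RSpace d → ℝ) (S : ℝ), AEStronglyMeasurable g → (∀ α, |g α| ≤ S) →
          Integrable (fun α => g α * (splineKernel k a x α - surfaceSpline d k (x - α))) ∧
          |∫ α, g α * (splineKernel k a x α - surfaceSpline d k (x - α))| ≤
            C * ρ x ^ (2 * k) * S := by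
  obtain ⟨C, hC, hdecay⟩ :=
    exists_abs_splineKernel_sub_le_mul_rpow (K := K) (Csg := Csg) hd hk hℓ hε hK hCsg
  set p : ℝ := ε * ℓ + d - 2 * k
  have hdp : finrank ℝ (RSpace d) < p := by
    rw [finrank_euclideanSpace_fin]
    linarith
  set I : ℝ := ∫ z : RSpace d, (1 + ‖z‖) ^ (-p)
  have : 0 ≤ I := integral_nonneg fun z => by positivity
  refine ⟨C * I + 1, by positivity, fun Ξ ρ a h hsg x hmeas g S hg hgS => ?_⟩
  have hx := h.pos x
  have hS : 0 ≤ S := (abs_nonneg _).trans (hgS 0)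
  have hbound (α : RSpace d) :
      ‖g α * (splineKernel k a x α - surfaceSpline d k (x - α))‖ ≤
        S * (C * ρ x ^ (2 * k - d)) * (1 + ‖x - α‖ / ρ x) ^ (-p) := by
    rw [norm_mul, Real.norm_eq_abs, Real.norm_eq_abs, mul_assoc S]
    exact mul_le_mul (hgS α) (hdecay Ξ ρ a h hsg x α) (abs_nonneg _) hS
  have hint := (integrable_one_add_norm_sub_div_rpow volume hdp hx x).const_mul
    (S * (C * ρ x ^ (2 * k - d)))
  have hφ := continuous_surfaceSpline_sub hk x
  refine ⟨hint.mono' (hg.mul (hmeas.sub hφ.aestronglyMeasurable)) (.of_forall hbound), ?_⟩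
  calc |∫ α, g α * (splineKernel k a x α - surfaceSpline d k (x - α))|
      ≤ ∫ α, S * (C * ρ x ^ (2 * k - d)) * (1 + ‖x - α‖ / ρ x) ^ (-p) :=
        norm_integral_le_of_norm_le hint (.of_forall hbound)
    _ = C * I * (ρ x ^ (2 * k - d) * ρ x ^ d) * S := by
        rw [integral_const_mul, integral_one_add_norm_sub_div_rpow volume p hx,
          finrank_euclideanSpace_fin]
        ring
    _ = C * I * ρ x ^ (2 * k) * S := by rw [← pow_add, Nat.sub_add_cancel hk.le]
    _ ≤ (C * I + 1) * ρ x ^ (2 * k) * S := by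
        gcongr
        linarith

end Approximation

theorem theorem1 (d k ℓ : ℕ) (hd : 0 < d) (hk : d < 2 * k)
    (hℓ : (ℓ : ℤ) > 2 * (k : ℤ) - (d : ℤ) + 1)
    (ε K Csg : ℝ) (hε : ε > 2 * (k : ℝ) / (ℓ : ℝ)) (hK : 0 < K) (hCsg : 0 < Csg) :
    ∃ C : ℝ, 0 < C ∧
      ∀ (Ξ : Set (RSpace d)) (ρ : RSpace d → ℝ) (a : Ξ → RSpace d → ℝ),
        IsLocalDensity Ξ ρ a ℓ K →
        (∀ x : RSpace d,
          MeasureTheory.AEStronglyMeasurable (splineKernel k a x) MeasureTheory.volume) →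
        SlowGrowth ρ ε Csg →
        ∀ f : RSpace d → ℝ, ContDiff ℝ (2 * k : ℕ) f → HasCompactSupport f →
          ∀ x : RSpace d,
            (∀ α : RSpace d, Summable (fun ξ : Ξ => a ξ α * surfaceSpline d k (x - ξ))) ∧
            MeasureTheory.Integrable
              (fun α => iteratedLaplacian k f α * splineKernel k a x α) MeasureTheory.volume ∧
            |f x - splineApproximant k a f x| ≤
              C * ρ x ^ (2 * k) * ⨆ y : RSpace d, |iteratedLaplacian k f y| := by
  have hℓ' : 2 * k - d < ℓ := by lia
  have hε' : 2 * k < ε * ℓ := (div_lt_iff₀ (Nat.cast_pos.mpr hℓ'.pos)).mp hε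
  obtain ⟨C, hC, herror⟩ :=
    exists_abs_integral_mul_splineKernel_sub_le hd hk hℓ' hε' hK.le hCsg.le
  refine ⟨C, hC, fun Ξ ρ a h hmeas hsg f hf hc x => ?_⟩
  have hg := continuous_iteratedLaplacian hf
  have hgc := hasCompactSupport_iteratedLaplacian hc k
  have hφ := continuous_surfaceSpline_sub hk x
  have hint : Integrable fun α => iteratedLaplacian k f α * surfaceSpline d k (x - α) :=
    (hg.mul hφ).integrable_of_hasCompactSupport hgc.mul_right
  have hbdd : BddAbove (Set.range fun y => |iteratedLaplacian k f y|) :=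
    hg.abs.bddAbove_range_of_hasCompactSupport hgc.norm
  obtain ⟨herrInt, herrLe⟩ :=
    herror Ξ ρ a h hsg x (hmeas x) _ _ hg.aestronglyMeasurable fun y => le_ciSup hbdd y
  have hsplit : (fun α => iteratedLaplacian k f α * splineKernel k a x α) = fun α =>
      iteratedLaplacian k f α * (splineKernel k a x α - surfaceSpline d k (x - α)) +
        iteratedLaplacian k f α * surfaceSpline d k (x - α) := by
    funext α
    ring
  refine ⟨fun α => h.summable_mul hφ α, by rw [hsplit]; exact herrInt.add hint, ?_⟩
  have hgap : f x - splineApproximant k a f x =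
      -∫ α, iteratedLaplacian k f α * (splineKernel k a x α - surfaceSpline d k (x - α)) := by
    rw [splineApproximant, hsplit, integral_add herrInt hint,
      integral_iteratedLaplacian_mul_surfaceSpline hd hk hf hc]
    ring
  rwa [hgap, abs_neg]
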